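/- Let $P$ be a finite poset with $n$ elements, let $\lambda=(\lambda_1\ge\dots\ge\lambda_r)$ be a partition of $n$, and let $\mathrm{inc}(P)$ be the graph on $P$ whose edges join incomparable elements. For $w\in S_n$ let $\psi^\lambda(w)=z_\lambda=\lambda_1\cdots\lambda_r\,\alpha_1!\cdots\alpha_n!$ if $w$ has cycle type $\lambda$ (where $\alpha_i$ is the number of parts of $\lambda$ equal to $i$) and $\psi^\lambda(w)=0$ otherwise; let $\epsilon^\mu$ be the character of $S_n$ induced from the sign character of the Young subgroup $S_\mu$; extend both linearly to $\mathbb{Q}[S_n]$. For $g\in\mathbb{Q}[S_n]$ put $Y(g)=\sum_{\mu\vdash n}\epsilon^\mu(g)\,m_\mu$, where $m_\mu$ is the monomial symmetric function, and let $X_{\mathrm{inc}(P)}=\sum_\kappa\prod_{v\in P}x_{\kappa(v)}$, summed over the proper colorings $\kappa$ of $\mathrm{inc}(P)$, be the chromatic symmetric function. Then there is a $g\in\mathbb{Q}[S_n]$ with $Y(g)=X_{\mathrm{inc}(P)}$, and for every such $g$ the number $\psi^\lambda(\mathrm{inc}(P)):=\psi^\lambda(g)$ is equal to each of the following. (1)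 The number of cyclically row-semistrict $P$-tableaux of shape $\lambda$. Here a $P$-tableau $U$ of shape $\lambda$ is a filling of the boxes $(i,j)$, $1\le i\le r$, $1\le j\le\lambda_i$, with the elements of $P$, each used once; it is row-semistrict if $U_{i,j}\not>_P U_{i,j+1}$ for all $i$ and all $j<\lambda_i$, and cyclically row-semistrict if moreover $U_{i,\lambda_i}\not>_P U_{i,1}$ for all $i$. (2) The number of $P$-record-free, row-semistrict $P$-tableaux of shape $\lambda$, where $U$ is $P$-record-free if there is no $(i,j)$ with $j\ne1$ and $U_{i,1},\dots,U_{i,j-1}<_P U_{i,j}$. (3) The number of ordered disjoint cycle covers $(H_1,\dots,H_r)$ of type $\lambda$ of the digraph $\mathrm{ngr}(P)$, each $H_j$ taken with a distinguished starting vertex; equivalently, $\lambda_1\cdots\lambda_r$ times the number of ordered disjoint cycle covers of type $\lambda$ of $\mathrm{ngr}(P)$. Here $\mathrm{ngr}(P)$ has vertex set $P$ and an edge $(a,b)$ whenever $a\not>_P b$ (including all loops $(a,a)$), and an ordered disjoint cycle cover of type $\lambda$ is a sequence $(H_1,\dots,H_r)$ of vertex-disjoint subgraphs such that $H_j$ is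 isomorphic to the directed cycle on $\lambda_j$ vertices (a loop if $\lambda_j=1$). (4) The number of pairs consisting of an ordered set partition $(I_1,\dots,I_r)$ of $P$ with $|I_j|=\lambda_j$ and a sequence $(O_1,\dots,O_r)$, where $O_j$ is an acyclic orientation, with exactly one source, of the subgraph of $\mathrm{inc}(P)$ induced by $I_j$. -/

import Mathlib

noncomputable section

namespace PosetTrace

/-! ### Partitions -/

/-- The parts of a partition listed in weakly decreasing order, `(λ₁, …, λᵣ)`, as a composition. -/
def rows {n : ℕ} (lam : n.Partition) : Composition n where
  blocks := lam.parts.sort (· ≥ ·)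
  blocks_pos := fun hi => lam.parts_pos ((Multiset.mem_sort _).1 hi)
  blocks_sum := by
    have h := lam.parts_sum
    rw [← Multiset.sort_eq lam.parts (· ≥ ·), Multiset.sum_coe] at h
    exact h

/-- `z_λ = λ₁ ⋯ λᵣ α₁! ⋯ αₙ!`, where `αᵢ` is the number of parts equal to `i`. -/
def zCoeff {n : ℕ} (lam : n.Partition) : ℕ :=
  lam.parts.prod * ∏ i ∈ Finset.Icc 1 n, (lam.parts.count i).factorial

/-! ### Traces of the symmetric group -/

/-- The class function induced from a function on a subgroup of a finite group. -/
def inducedFunction {Γ : Type*} [Group Γ] [Fintype Γ] (H : Subgroup Γ) (f : Γ → ℚ) (w : Γ) : ℚ :=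
  open Classical in
  (Nat.card H : ℚ)⁻¹ * ∑ x : Γ, if x⁻¹ * w * x ∈ H then f (x⁻¹ * w * x) else 0

/-- The Young subgroup of `λ`: the permutations that preserve each of the consecutive
blocks of sizes `λ₁, …, λᵣ`. -/
def youngSubgroup {n : ℕ} (lam : n.Partition) : Subgroup (Equiv.Perm (Fin n)) where
  carrier := {w | ∀ i, (rows lam).index (w i) = (rows lam).index i}
  mul_mem' := fun {a b} ha hb i => by
    rw [Equiv.Perm.mul_apply, ha, hb]
  one_mem' := fun _ => rfl
  inv_mem' := fun {a} ha i => by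
    have h := ha (a.symm i)
    rw [Equiv.apply_symm_apply] at h
    exact h.symm

/-- The induced sign character `ε^λ`. -/
def inducedSign {n : ℕ} (lam : n.Partition) (w : Equiv.Perm (Fin n)) : ℚ :=
  inducedFunction (youngSubgroup lam) (fun v => ((Equiv.Perm.sign v : ℤ) : ℚ)) w

/-- The power sum trace `ψ^λ`. -/
def powerSumTrace {n : ℕ} (lam : n.Partition) (w : Equiv.Perm (Fin n)) : ℚ :=
  if w.partition.parts = lam.parts then (zCoeff lam : ℚ) else 0

/-- The linear extension to the group algebra of a function on a group, evaluated at `g`. -/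
def evalAt {Γ : Type*} [Group Γ] (θ : Γ → ℚ) (g : MonoidAlgebra ℚ Γ) : ℚ :=
  g.coeff.sum fun w a => a * θ w

/-! ### Symmetric functions, as power series in the variables `x₀, x₁, x₂, …` -/

/-- The monomial symmetric function `m_λ`: the sum of all monomials whose multiset of nonzero
exponents is `λ`. -/
def monomialSymm {n : ℕ} (lam : n.Partition) : MvPowerSeries ℕ ℚ :=
  fun d => if d.support.val.map d = lam.parts then 1 else 0

/-- `Y(g) = ∑_λ ε^λ(g) m_λ`. -/
def symmGen {n : ℕ} (g : MonoidAlgebra ℚ (Equiv.Perm (Fin n))) : MvPowerSeries ℕ ℚ :=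
  ∑ lam : n.Partition, evalAt (inducedSign lam) g • monomialSymm lam

/-- The chromatic symmetric function `X_G`: the sum of `∏ᵥ x_{κ(v)}` over the proper
colorings `κ`, given by its coefficients. -/
def chromaticSymm {V : Type*} [Fintype V] (G : SimpleGraph V) : MvPowerSeries ℕ ℚ :=
  fun d => (Nat.card {κ : G.Coloring ℕ // ∑ v, Finsupp.single (κ v) 1 = d} : ℚ)

/-! ### Tableaux -/

/-- The boxes of the diagram of `λ`: box `⟨i, j⟩` is the `j`th box of the `i`th row. -/
abbrev Box {n : ℕ} (lam : n.Partition) : Type :=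
  (i : Fin (rows lam).length) × Fin ((rows lam).blocksFun i)

/-- A `P`-tableau of shape `λ`: the elements of `P` placed one per box. -/
abbrev PTableau (P : Type*) {n : ℕ} (lam : n.Partition) : Type _ := Box lam ≃ P

section Tableaux

variable {P : Type*} [PartialOrder P] {n : ℕ} {lam : n.Partition}

/-- No entry of a row is greater than the entry immediately to its right. -/
def RowSemistrict (U : PTableau P lam) : Prop :=
  ∀ (i : Fin (rows lam).length) (j k : Fin ((rows lam).blocksFun i)),
    (k : ℕ) = j + 1 → ¬ U ⟨i, j⟩ > U ⟨i, k⟩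

/-- Row-semistrict, and the last entry of a row is never greater than the first one. -/
def CyclicallyRowSemistrict (U : PTableau P lam) : Prop :=
  RowSemistrict U ∧
  ∀ (i : Fin (rows lam).length) (j k : Fin ((rows lam).blocksFun i)),
    (j : ℕ) = 0 → (k : ℕ) + 1 = (rows lam).blocksFun i → ¬ U ⟨i, k⟩ > U ⟨i, j⟩

/-- The entry in box `b` is greater than all entries to its left in the same row. -/
def IsPRecord (U : PTableau P lam) (b : Box lam) : Prop :=
  ∀ k : Fin ((rows lam).blocksFun b.1), k < b.2 → U ⟨b.1, k⟩ < U b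

/-- All `P`-records are in the first column. -/
def PRecordFree (U : PTableau P lam) : Prop :=
  ∀ b : Box lam, IsPRecord U b → (b.2 : ℕ) = 0

end Tableaux

/-! ### The graphs of a poset -/

/-- The incomparability graph of a poset. -/
def incGraph (P : Type*) [PartialOrder P] : SimpleGraph P where
  Adj a b := IncompRel (· ≤ ·) a b
  symm := ⟨fun _ _ h => h.symm⟩
  loopless := ⟨fun _ h => h.1 le_rfl⟩

/-- The digraph with an edge `(a, b)`, possibly a loop, whenever `a` is not greater than `b`. -/
def ngrDigraph (P : Type*) [PartialOrder P] : Digraph P where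
  Adj a b := ¬ a > b

/-! ### Cycle covers -/

/-- A subgraph of a digraph: a set of vertices and a set of edges between them. -/
@[ext]
structure DiSubgraph {V : Type*} (D : Digraph V) where
  verts : Set V
  Adj : V → V → Prop
  adj_sub : ∀ {a b}, Adj a b → D.Adj a b
  fst_mem : ∀ {a b}, Adj a b → a ∈ verts
  snd_mem : ∀ {a b}, Adj a b → b ∈ verts

/-- The directed cyclic graph on `m` vertices; a loop if `m = 1`. -/
def directedCycle (m : ℕ) : Digraph (Fin m) where
  Adj i j := (i + 1 : ℕ) % m = j

/-- The subgraph is isomorphic to the directed cyclic graph on `m` vertices. -/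
def DiSubgraph.IsCycle {V : Type*} {D : Digraph V} (H : DiSubgraph D) (m : ℕ) : Prop :=
  ∃ e : Fin m ≃ H.verts, ∀ i j, H.Adj (e i) (e j) ↔ (directedCycle m).Adj i j

/-- The ordered disjoint cycle covers of `D` of type `λ`: sequences of vertex-disjoint directed
cyclic subgraphs with `λ₁, …, λᵣ` vertices. -/
def cycleCovers {V : Type*} (D : Digraph V) {n : ℕ} (lam : n.Partition) :
    Set (Fin (rows lam).length → DiSubgraph D) :=
  {H | Pairwise (fun i j => Disjoint (H i).verts (H j).verts) ∧
    ∀ i, (H i).IsCycle ((rows lam).blocksFun i)}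

/-- The ordered disjoint cycle covers in which a starting vertex is chosen on each cycle. -/
def rootedCycleCovers {V : Type*} (D : Digraph V) {n : ℕ} (lam : n.Partition) :
    Set ((Fin (rows lam).length → DiSubgraph D) × (Fin (rows lam).length → V)) :=
  {C | C.1 ∈ cycleCovers D lam ∧ ∀ i, C.2 i ∈ (C.1 i).verts}

/-! ### Acyclic orientations -/

/-- Each edge of `G` is replaced by exactly one of its two directed versions. -/
def IsOrientation {V : Type*} (G : SimpleGraph V) (O : Digraph V) : Prop :=
  (∀ a b, O.Adj a b → G.Adj a b) ∧ ∀ a b, G.Adj a b → Xor (O.Adj a b) (O.Adj b a)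

/-- There is no directed cycle. -/
def IsAcyclicDigraph {V : Type*} (O : Digraph V) : Prop :=
  ∀ a, ¬ Relation.TransGen O.Adj a a

/-- A source is a vertex without incoming edges. -/
def IsSource {V : Type*} (O : Digraph V) (v : V) : Prop := ∀ u, ¬ O.Adj u v

/-- The ordered set partitions `(I₁, …, Iᵣ)` of `V` of type `λ`. -/
def orderedSetPartitions (V : Type*) {n : ℕ} (lam : n.Partition) :
    Set (Fin (rows lam).length → Set V) :=
  {I | (∀ i, (I i).ncard = (rows lam).blocksFun i) ∧
    Pairwise (fun i j => Disjoint (I i) (I j)) ∧ ⋃ i, I i = Set.univ}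

/-- The pairs consisting of an ordered set partition `(I₁, …, Iᵣ)` of type `λ`, that is, of an
ordered induced subgraph partition of `G` of type `λ`, and of a sequence `(O₁, …, Oᵣ)` in which
`Oᵢ` is an acyclic orientation, with exactly one source, of the subgraph induced by `Iᵢ`. -/
abbrev OneSourceOrientations {V : Type*} (G : SimpleGraph V) {n : ℕ} (lam : n.Partition) : Type _ :=
  (I : orderedSetPartitions V lam) ×
    ((i : Fin (rows lam).length) →
      {O : Digraph (I.1 i) //
        IsOrientation (G.induce (I.1 i)) O ∧ IsAcyclicDigraph O ∧ ∃! v, IsSource O v})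

end PosetTrace

end

open PosetTrace

noncomputable section

open scoped Classical

namespace PosetTrace

/-! A suitable `g` is the sum of all permutations `σ` of `P` with `a ≯ σ a` for every `a`,
transported to `S_n` (`ngrElement`). The coefficient of `Y(g)` at a monomial of exponent `d` is the
sum of `sign σ` over pairs of such a `σ` and a coloring of content `d` constant on the cycles of `σ`
(`symmGen_apply`). For a fixed coloring the signed sum over `σ` is a determinant: it is 1 if all
color classes are chains and 0 otherwise, because two columns then coincide (`sign_sum_eq`). Chains
as color classes mean a proper coloring of `inc(P)`, so `Y(g) = X_{inc(P)}`.

Linear independence of the power sums shows that `Y(g)` determines the sum of the coefficients of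
`g` over each conjugacy class, hence `ψ^λ(g)` (`evalAt_powerSumTrace_congr`). For the element above,
`ψ^λ(g)` is `z_λ` times the number of its `σ` of cycle type `λ`. Since `z_λ` is the order of a
centralizer, each such `σ` comes from `z_λ` tableaux by rotating the rows; this is (1). Reading the
rows as rooted cycles gives (3).

The other two counts are compared one block at a time. Orienting incomparable letters from left to
right matches record-free semistrict words with acyclic orientations having one source, so (2)
equals (4). For (1) and (4), `card_oneSourceOn` shows that a set `S` carries as many admissible
cycles as acyclic orientations with only source `v`, for every `v ∈ S`. Both numbers satisfy the
recursion `∑ (-1)^|T| x(T) [S \ T is a chain] = -[S is a chain]`, summed over `v ∈ T ⊆ S`: for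
cycles, split off the cycle through `v` in the determinant identity; for orientations, toggle a
sink. The `|S|` starting points of a cycle then match the `|S|` possible sources. -/

/-! ### Signed permutations and chains -/

/-- The entries of the permutation are never greater than their images. -/
def IsNgrPerm {P : Type*} [PartialOrder P] (σ : Equiv.Perm P) : Prop := ∀ a, ¬ a > σ a

/-- On chains the condition becomes `a ≤ σ a`; since `σ` has finite order, going once around a cycle
forces equality, so only the identity contributes. -/
theorem sign_sum_eq_one {P α : Type*} [Fintype P] [PartialOrder P] (κ : P → α)
    (h : ∀ a b, κ a = κ b → a ≤ b ∨ b ≤ a) :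
    ∑ σ : Equiv.Perm P with IsNgrPerm σ ∧ ∀ a, κ (σ a) = κ a,
      ((Equiv.Perm.sign σ : ℤ) : ℚ) = 1 := by
  have : (Finset.univ.filter fun σ : Equiv.Perm P => IsNgrPerm σ ∧ ∀ a, κ (σ a) = κ a) = {1} := by
    ext σ
    simp only [Finset.mem_filter, Finset.mem_univ, true_and, Finset.mem_singleton]
    constructor
    · rintro ⟨h1, h2⟩
      have hle : ∀ a, a ≤ σ a := fun a => by
        rcases h _ _ (h2 a) with h3 | h3
        · by_contra h4
          exact h1 a (lt_of_le_not_ge h3 h4)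
        · exact h3
      have hpow : ∀ (k : ℕ) a, a ≤ (σ ^ k) a := by
        intro k
        induction k with
        | zero => intro a; simp
        | succ k ih =>
          intro a
          rw [pow_succ', Equiv.Perm.mul_apply]
          exact (ih a).trans (hle _)
      ext a
      refine le_antisymm ?_ (hle a)
      have h5 := hpow (orderOf σ - 1) (σ a)
      rw [← Equiv.Perm.mul_apply, ← pow_succ, Nat.sub_add_cancel (orderOf_pos σ),
        pow_orderOf_eq_one] at h5
      simpa using h5
    · rintro rfl
      exact ⟨fun a => by simp, fun a => by simp⟩
  rw [this]
  simp

/-- Take an incomparable pair of one color that is minimal in the product order. If `x < a` has the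
same color, minimality makes `x` and `b` comparable, and `b ≤ x` would give `b ≤ a`. These `a`, `b`
yield the two equal columns of the determinant below. -/
theorem exists_incomp_same_lower {P α : Type*} [Fintype P] [PartialOrder P] (κ : P → α)
    (h : ∃ a b, κ a = κ b ∧ ¬ (a ≤ b ∨ b ≤ a)) :
    ∃ a b, a ≠ b ∧ κ a = κ b ∧ ∀ x, κ x = κ a → (x < a ↔ x < b) := by
  obtain ⟨a, b, hab⟩ := h
  let S : Set (P × P) := {p | κ p.1 = κ p.2 ∧ ¬ (p.1 ≤ p.2 ∨ p.2 ≤ p.1)}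
  have hS : S.Nonempty := ⟨(a, b), hab⟩
  obtain ⟨⟨a, b⟩, h1⟩ := S.toFinite.exists_minimal hS
  have hm := h1.prop
  obtain ⟨hk, hi⟩ : κ a = κ b ∧ ¬ (a ≤ b ∨ b ≤ a) := hm
  refine ⟨a, b, ?_, hk, fun x hx => ⟨fun hxa => ?_, fun hxb => ?_⟩⟩
  · rintro rfl; simp at hi
  · have : (x, b) ∉ S := fun h2 => by
      have := h1.le_of_le h2 (Prod.mk_le_mk.2 ⟨hxa.le, le_rfl⟩)
      exact hxa.not_ge (Prod.mk_le_mk.1 this).1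
    simp only [S, Set.mem_ofPred_eq, not_and, not_not] at this
    rcases this (hx.trans hk) with h3 | h3
    · refine lt_of_le_of_ne h3 ?_
      rintro rfl
      exact hi (Or.inr hxa.le)
    · exact absurd (Or.inr (h3.trans hxa.le)) hi
  · have : (a, x) ∉ S := fun h2 => by
      have := h1.le_of_le h2 (Prod.mk_le_mk.2 ⟨le_rfl, hxb.le⟩)
      exact hxb.not_ge (Prod.mk_le_mk.1 this).2
    simp only [S, Set.mem_ofPred_eq, not_and, not_not] at this
    rcases this hx.symm with h3 | h3
    · exact absurd (Or.inl (h3.trans hxb.le)) hi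
    · refine lt_of_le_of_ne h3 ?_
      rintro rfl
      exact hi (Or.inl hxb.le)

/-- The signed number of permutations of a poset that preserve a coloring and never send an
element to a smaller one. -/
theorem sign_sum_eq {P α : Type*} [Fintype P] [PartialOrder P] (κ : P → α) :
    ∑ σ : Equiv.Perm P with IsNgrPerm σ ∧ ∀ a, κ (σ a) = κ a,
      ((Equiv.Perm.sign σ : ℤ) : ℚ) = if ∀ a b, κ a = κ b → a ≤ b ∨ b ≤ a then 1 else 0 := by
  split_ifs with h
  · exact sign_sum_eq_one κ h
  · push Not at h
    obtain ⟨a, b, hne, hk, hx⟩ := exists_incomp_same_lower κ (by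
      obtain ⟨a, b, h1, h2⟩ := h
      exact ⟨a, b, h1, by tauto⟩)
    -- The Leibniz expansion of `M.det` is the signed sum. Columns `a` and `b` agree because `a` and
    -- `b` have the same color and the same lower elements in it.
    let M : Matrix P P ℚ := fun x y => if ¬ y > x ∧ κ x = κ y then 1 else 0
    have hdet : M.det = 0 := by
      refine Matrix.det_zero_of_column_eq hne fun x => ?_
      simp only [M]
      congr 1
      simp only [gt_iff_lt, eq_iff_iff, hk]
      by_cases h3 : κ x = κ b
      · rw [hx x (h3.trans hk.symm)]
      · simp [h3]
    rw [Matrix.det_apply] at hdet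
    rw [← hdet, Finset.sum_filter]
    refine Finset.sum_congr rfl fun σ _ => ?_
    have hprod : ∏ i, M (σ i) i = if IsNgrPerm σ ∧ ∀ a, κ (σ a) = κ a then 1 else 0 := by
      split_ifs with h4
      · exact Finset.prod_eq_one fun i _ => if_pos ⟨h4.1 i, h4.2 i⟩
      · rw [IsNgrPerm, ← forall_and] at h4
        push Not at h4
        obtain ⟨i, hi⟩ := h4
        exact Finset.prod_eq_zero (Finset.mem_univ i) (if_neg fun h5 => hi h5.1 h5.2)
    rw [hprod]
    split_ifs <;> simp [Units.smul_def]

/-! ### Row rotation, centralizers and tableaux -/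

theorem map_blocksFun_rows {n : ℕ} (lam : n.Partition) :
    (Finset.univ.val.map (rows lam).blocksFun) = lam.parts := by
  rw [Fin.univ_val_map, Composition.ofFn_blocksFun]
  exact Multiset.sort_eq lam.parts (· ≥ ·)

theorem prod_blocksFun_rows {n : ℕ} (lam : n.Partition) :
    ∏ i, (rows lam).blocksFun i = lam.parts.prod := by
  rw [← map_blocksFun_rows lam, Finset.prod]

theorem card_box {n : ℕ} (lam : n.Partition) : Fintype.card (Box lam) = n := by
  rw [Fintype.card_congr (rows lam).blocksFinEquiv, Fintype.card_fin]

/-- Every row of the diagram is rotated to the right by one box. -/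
def rotateRows {n : ℕ} (lam : n.Partition) : Equiv.Perm (Box lam) :=
  Equiv.Perm.sigmaCongrRight fun i => finRotate ((rows lam).blocksFun i)

/-- Such a permutation is the extension by the identity of `f` from one fibre, which does not change
the cycle type. -/
theorem cycleType_sigmaCongrRight_mulSingle {ι : Type*} [Fintype ι] {β : ι → Type*}
    [∀ i, Fintype (β i)] [∀ i, DecidableEq (β i)] [DecidableEq (Σ i, β i)] (i : ι)
    (f : Equiv.Perm (β i)) :
    (Equiv.Perm.sigmaCongrRight (Pi.mulSingle i f : ∀ i, Equiv.Perm (β i))).cycleType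
      = f.cycleType := by
  rw [← Equiv.Perm.cycleType_extendDomain (Equiv.sigmaSubtype (β := β) i).symm (g := f)]
  congr 1
  refine Equiv.ext ?_
  rintro ⟨j, x⟩
  by_cases h : j = i
  · subst h
    have := Equiv.Perm.extendDomain_apply_image f (Equiv.sigmaSubtype (β := β) j).symm x
    refine Eq.trans ?_ this.symm
    simp [Equiv.sigmaSubtype]
  · rw [Equiv.Perm.extendDomain_apply_not_subtype f (Equiv.sigmaSubtype (β := β) i).symm
      (b := (⟨j, x⟩ : Σ i, β i)) h]
    simp [Pi.mulSingle_eq_of_ne h]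

/-- The permutation is a product of disjoint ones, each acting on a single fibre. -/
theorem cycleType_sigmaCongrRight {ι : Type*} [Fintype ι] {β : ι → Type*}
    [∀ i, Fintype (β i)] [∀ i, DecidableEq (β i)] [DecidableEq (Σ i, β i)]
    (f : ∀ i, Equiv.Perm (β i)) :
    (Equiv.Perm.sigmaCongrRight f).cycleType = ∑ i, (f i).cycleType := by
  have hd : Pairwise fun i j => Equiv.Perm.Disjoint
      (Equiv.Perm.sigmaCongrRight (Pi.mulSingle i (f i)))
      (Equiv.Perm.sigmaCongrRight (Pi.mulSingle j (f j))) := by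
    rintro i j hij ⟨k, x⟩
    by_cases h : k = i
    · subst h
      right
      simp [Pi.mulSingle_eq_of_ne hij]
    · left
      simp [Pi.mulSingle_eq_of_ne h]
  have h1 : Equiv.Perm.sigmaCongrRight f = Finset.univ.noncommProd
      (fun i => Equiv.Perm.sigmaCongrRight (Pi.mulSingle i (f i)))
      (fun i _ j _ hij => (hd hij).commute) := by
    conv_lhs => rw [← Finset.noncommProd_mulSingle f]
    exact Finset.map_noncommProd _ _ _ (Equiv.Perm.sigmaCongrRightHom β)
  rw [h1, Equiv.Perm.Disjoint.cycleType_noncommProd (fun i _ j _ hij => hd hij)]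
  simp only [cycleType_sigmaCongrRight_mulSingle]

theorem cycleType_finRotate_eq (m : ℕ) :
    (finRotate m).cycleType = ({m} : Multiset ℕ).filter (2 ≤ ·) := by
  by_cases h : 2 ≤ m
  · rw [cycleType_finRotate_of_le h]
    simp [Multiset.filter_singleton, h]
  · have : Subsingleton (Fin m) := by
      rw [Fin.subsingleton_iff_le_one]; omega
    rw [Subsingleton.elim (finRotate m) 1]
    simp [Multiset.filter_singleton, h]

theorem cycleType_rotateRows {n : ℕ} (lam : n.Partition) :
    (rotateRows lam).cycleType = lam.parts.filter (2 ≤ ·) := by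
  rw [rotateRows, cycleType_sigmaCongrRight]
  simp only [cycleType_finRotate_eq]
  conv_rhs => rw [← map_blocksFun_rows lam]
  rw [← Multiset.sum_map_singleton (Multiset.map _ _), Multiset.map_map]
  exact (map_sum (⟨⟨Multiset.filter (2 ≤ ·), rfl⟩, Multiset.filter_add _⟩ :
    Multiset ℕ →+ Multiset ℕ) (fun i => {(rows lam).blocksFun i}) Finset.univ).symm

/-- `cycleType` omits fixed points; the number of parts 1 is recovered from `n`. -/
theorem parts_eq_filter_add {n : ℕ} (lam : n.Partition) :
    lam.parts = lam.parts.filter (2 ≤ ·) +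
      Multiset.replicate (n - (lam.parts.filter (2 ≤ ·)).sum) 1 := by
  have h1 := Multiset.filter_add_not (2 ≤ ·) lam.parts
  have h2 : lam.parts.filter (fun i => ¬ 2 ≤ i) =
      Multiset.replicate (lam.parts.filter (fun i => ¬ 2 ≤ i)).card 1 := by
    refine Multiset.eq_replicate_card.2 fun b hb => ?_
    rw [Multiset.mem_filter] at hb
    have := lam.parts_pos hb.1
    omega
  have h3 := congrArg Multiset.sum h1
  rw [Multiset.sum_add, lam.parts_sum, h2, Multiset.sum_replicate, smul_eq_mul, mul_one] at h3
  conv_lhs => rw [← h1, h2]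
  congr 2
  omega

/-- The cycle type of a permutation, counting fixed points, is `λ`. -/
theorem partition_parts_eq_iff {α : Type*} [Fintype α] [DecidableEq α] {n : ℕ}
    (hn : Fintype.card α = n) (lam : n.Partition) (σ : Equiv.Perm α) :
    σ.partition.parts = lam.parts ↔ σ.cycleType = lam.parts.filter (2 ≤ ·) := by
  subst hn
  rw [← Equiv.Perm.filter_parts_partition_eq_cycleType]
  refine ⟨fun h => by rw [h], fun h => ?_⟩
  rw [parts_eq_filter_add σ.partition, parts_eq_filter_add lam, h]

/-- The centralizer formula treats fixed points separately from longer cycles; their factorial is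
the factor `i = 1` of `z_λ`. -/
theorem zCoeff_eq_card_centralizer {n : ℕ} (lam : n.Partition) :
    zCoeff lam = Nat.card (Subgroup.centralizer {rotateRows lam}) := by
  rw [Equiv.Perm.nat_card_centralizer, cycleType_rotateRows, card_box, zCoeff]
  set c := lam.parts.filter (2 ≤ ·)
  set k := n - c.sum
  have h1 : lam.parts = c + Multiset.replicate k 1 := parts_eq_filter_add lam
  have hc1 : c.count 1 = 0 := Multiset.count_eq_zero.2 (by simp [c])
  have hprod : lam.parts.prod = c.prod := by rw [h1]; simp
  have hfac : ∀ i, (lam.parts.count i).factorial =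
      (c.count i).factorial * if 1 = i then k.factorial else 1 := by
    intro i
    rw [h1, Multiset.count_add, Multiset.count_replicate]
    split_ifs with h
    · subst h; simp [hc1]
    · simp
  rw [hprod, Finset.prod_congr rfl fun i _ => hfac i, Finset.prod_mul_distrib, Finset.prod_ite_eq]
  -- For `n = 0` the index 1 is missing from the product, but then `k! = 0! = 1`.
  have hk : (if 1 ∈ Finset.Icc 1 n then k.factorial else 1) = k.factorial := by
    split_ifs with h
    · rfl
    · have : n = 0 := by simpa using h
      have : k = 0 := by omega
      simp [this]
  have hsub : c.toFinset ⊆ Finset.Icc 1 n := by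
    intro i hi
    have hi' : i ∈ lam.parts := Multiset.mem_of_mem_filter (Multiset.mem_toFinset.1 hi)
    rw [Finset.mem_Icc]
    exact ⟨lam.parts_pos hi', (Multiset.le_sum_of_mem hi').trans_eq lam.parts_sum⟩
  rw [hk, Finset.prod_subset hsub fun i _ hi => by
    rw [Multiset.count_eq_zero.2 fun h => hi (Multiset.mem_toFinset.2 h), Nat.factorial_zero]]
  ring

/-- A tableau turns the row rotation into a permutation of its entries. -/
def rowPerm {P : Type*} {n : ℕ} {lam : n.Partition} (U : PTableau P lam) : Equiv.Perm P :=
  U.permCongr (rotateRows lam)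

theorem rowPerm_apply {P : Type*} {n : ℕ} {lam : n.Partition} (U : PTableau P lam) (b : Box lam) :
    rowPerm U (U b) = U (rotateRows lam b) := by
  simp [rowPerm]

theorem exists_rowPerm_eq_iff {P : Type*} [Fintype P] [DecidableEq P] {n : ℕ}
    (hn : Fintype.card P = n) (lam : n.Partition) (σ : Equiv.Perm P) :
    (∃ U : PTableau P lam, rowPerm U = σ) ↔ σ.partition.parts = lam.parts := by
  rw [partition_parts_eq_iff hn, ← cycleType_rotateRows]
  have hc : ∀ U : PTableau P lam, (rowPerm U).cycleType = (rotateRows lam).cycleType := by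
    intro U
    -- The rotation acts on boxes and `rowPerm U` on `P`; extending along the trivial predicate
    -- compares their cycle types.
    have h := Equiv.Perm.cycleType_extendDomain (p := fun _ : P => True)
      (U.trans (Equiv.Set.univ P).symm) (g := rotateRows lam)
    rw [← h]
    congr 1
  constructor
  · rintro ⟨U, rfl⟩
    exact hc U
  · intro h
    have U0 : PTableau P lam := Fintype.equivOfCardEq ((card_box lam).trans hn.symm)
    rw [← hc U0, ← Equiv.Perm.isConj_iff_cycleType_eq] at h
    obtain ⟨c, hc⟩ := isConj_iff.1 h.symm
    refine ⟨U0.trans c, ?_⟩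
    rw [← hc]
    ext a
    simp [rowPerm]

/-- Once one tableau `U0` is found, `U ↦ U0⁻¹ ∘ U` identifies all of them with the centralizer of
the row rotation. -/
theorem card_rowPerm_eq {P : Type*} [Fintype P] {n : ℕ} (hn : Fintype.card P = n)
    (lam : n.Partition) (σ : Equiv.Perm P) :
    Nat.card {U : PTableau P lam // rowPerm U = σ} =
      if σ.partition.parts = lam.parts then zCoeff lam else 0 := by
  have h0 := exists_rowPerm_eq_iff hn lam σ
  split_ifs with h <;> rw [← h0] at h
  · obtain ⟨U0, rfl⟩ := h
    rw [zCoeff_eq_card_centralizer]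
    refine Nat.card_congr ⟨fun U => ⟨U.1.trans U0.symm, ?_⟩, fun c => ⟨c.1.trans U0, ?_⟩, ?_, ?_⟩
    · rw [Subgroup.mem_centralizer_singleton_iff]
      ext1 b
      apply U0.injective
      have h1 := rowPerm_apply U.1 b
      rw [U.2] at h1
      have h2 := rowPerm_apply U0 (U0.symm (U.1 b))
      simp only [Equiv.apply_symm_apply] at h2
      simp [← h1, ← h2]
    · have h1 := Subgroup.mem_centralizer_singleton_iff.1 c.2
      ext a
      obtain ⟨b, rfl⟩ := (c.1.trans U0).surjective a
      rw [rowPerm_apply, Equiv.trans_apply, Equiv.trans_apply, rowPerm_apply]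
      exact congrArg U0 (DFunLike.congr_fun h1 b)
    · intro U; ext; simp
    · intro c; ext1; ext1 b; simp
  · have : IsEmpty {U : PTableau P lam // rowPerm U = σ} := ⟨fun U => h ⟨U.1, U.2⟩⟩
    exact Nat.card_of_isEmpty

theorem rotateRows_mk {n : ℕ} {lam : n.Partition} (i : Fin (rows lam).length)
    (j : Fin ((rows lam).blocksFun i)) :
    rotateRows lam ⟨i, j⟩ = ⟨i, finRotate _ j⟩ := rfl

theorem finRotate_val {m : ℕ} (j : Fin m) : (finRotate m j : ℕ) = (j + 1) % m := by
  cases m with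
  | zero => exact j.elim0
  | succ m =>
    rw [finRotate_apply, Fin.val_add]
    simp

/-- The successor conditions along a cyclic word. -/
theorem cyclic_iff {m : ℕ} {α : Type*} (R : α → α → Prop) (u : Fin m → α) :
    (∀ j, R (u j) (u (finRotate m j))) ↔
      (∀ j k : Fin m, (k : ℕ) = j + 1 → R (u j) (u k)) ∧
      ∀ j k : Fin m, (j : ℕ) = 0 → (k : ℕ) + 1 = m → R (u k) (u j) := by
  constructor
  · intro h
    refine ⟨fun j k hjk => ?_, fun j k hj hk => ?_⟩
    · have : finRotate m j = k := by
        ext; rw [finRotate_val, Nat.mod_eq_of_lt] <;> omega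
      exact this ▸ h j
    · have : finRotate m k = j := by
        ext; rw [finRotate_val, hk, Nat.mod_self, hj]
      exact this ▸ h k
  · rintro ⟨h1, h2⟩ j
    by_cases hj : (j : ℕ) + 1 = m
    · refine h2 _ _ ?_ hj
      rw [finRotate_val, hj, Nat.mod_self]
    · refine h1 _ _ ?_
      rw [finRotate_val, Nat.mod_eq_of_lt]
      omega

theorem cyclicallyRowSemistrict_iff {P : Type*} [PartialOrder P] {n : ℕ} {lam : n.Partition}
    (U : PTableau P lam) : CyclicallyRowSemistrict U ↔ IsNgrPerm (rowPerm U) := by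
  have h1 : IsNgrPerm (rowPerm U) ↔ ∀ i j, ¬ U ⟨i, j⟩ > U ⟨i, finRotate _ j⟩ := by
    rw [IsNgrPerm, ← U.forall_congr_right, Sigma.forall]
    simp only [rowPerm_apply, rotateRows_mk]
  rw [h1, CyclicallyRowSemistrict, RowSemistrict, ← forall_and]
  refine forall_congr' fun i => ?_
  exact (cyclic_iff (fun a b => ¬ a > b) (fun j => U ⟨i, j⟩)).symm

theorem ncard_cyclicallyRowSemistrict {P : Type*} [Fintype P] [PartialOrder P] {n : ℕ}
    (hn : Fintype.card P = n) (lam : n.Partition) :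
    {U : PTableau P lam | CyclicallyRowSemistrict U}.ncard =
      ∑ σ : Equiv.Perm P with IsNgrPerm σ,
        if σ.partition.parts = lam.parts then zCoeff lam else 0 := by
  simp only [cyclicallyRowSemistrict_iff, ← card_rowPerm_eq hn]
  rw [Set.ncard_eq_toFinset_card', Finset.card_eq_sum_card_fiberwise (f := rowPerm)
    (t := Finset.univ.filter IsNgrPerm) (fun U hU => by simpa using hU)]
  refine Finset.sum_congr rfl fun σ hσ => ?_
  rw [Nat.card_eq_fintype_card, Fintype.card_subtype]
  congr 1
  ext U
  simp only [Finset.mem_filter, Finset.mem_univ, true_and, Set.mem_toFinset,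
    Set.mem_ofPred_eq] at hσ ⊢
  constructor
  · exact fun h => h.2
  · rintro rfl; exact ⟨hσ, rfl⟩

/-! ### Colorings and the coefficients of `Y(g)` -/

/-- The number of times each color is used by a coloring. -/
def content {α : Type*} [Fintype α] (f : α → ℕ) : ℕ →₀ ℕ := ∑ i, Finsupp.single (f i) 1

theorem content_apply {α : Type*} [Fintype α] (f : α → ℕ) (k : ℕ) :
    content f k = Fintype.card {i // f i = k} := by
  rw [content, Finsupp.finsetSum_apply, Fintype.card_subtype, Finset.card_filter]
  exact Finset.sum_congr rfl fun i _ => Finsupp.single_apply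

theorem content_comp_equiv {α β : Type*} [Fintype α] [Fintype β] (e : α ≃ β) (f : β → ℕ) :
    content (f ∘ e) = content f :=
  Equiv.sum_comp e fun i => Finsupp.single (f i) 1

theorem exists_equiv_of_content_eq {α β : Type*} [Fintype α] [Fintype β] {f : α → ℕ} {g : β → ℕ}
    (h : content f = content g) : ∃ e : α ≃ β, g ∘ e = f := by
  have e : ∀ k, {i // f i = k} ≃ {i // g i = k} := fun k =>
    Fintype.equivOfCardEq (by rw [← content_apply, ← content_apply, h])
  refine ⟨((Equiv.sigmaFiberEquiv f).symm.trans (Equiv.sigmaCongrRight e)).trans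
    (Equiv.sigmaFiberEquiv g), funext fun i => ?_⟩
  exact (e (f i) ⟨i, rfl⟩).2

theorem exists_equiv_of_map_eq {α β : Type*} [Fintype α] [Fintype β] {f : α → ℕ} {g : β → ℕ}
    (h : Finset.univ.val.map f = Finset.univ.val.map g) : ∃ e : α ≃ β, g ∘ e = f := by
  refine exists_equiv_of_content_eq ?_
  have := congrArg (fun s => (s.map fun k => Finsupp.single k 1).sum) h
  rw [Multiset.map_map, Multiset.map_map] at this
  exact this

theorem mem_support_content {α : Type*} [Fintype α] (f : α → ℕ) (i : α) :
    f i ∈ (content f).support := by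
  rw [Finsupp.mem_support_iff, content_apply]
  exact (Fintype.card_pos_iff.2 ⟨⟨i, rfl⟩⟩).ne'

theorem sum_content {α : Type*} [Fintype α] (f : α → ℕ) :
    ((content f).support.val.map (content f)).sum = Fintype.card α := by
  change (content f).sum (fun _ m => m) = _
  rw [content, ← Finsupp.sum_finsetSum_index (by simp) (by simp)]
  simp

/-- The colorings in which each color is used a prescribed number of times. -/
def colorings (α : Type*) [Fintype α] (d : ℕ →₀ ℕ) : Finset (α → ℕ) :=
  (Fintype.piFinset fun _ => d.support).filter fun f => content f = d

theorem mem_colorings {α : Type*} [Fintype α] {d : ℕ →₀ ℕ} {f : α → ℕ} :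
    f ∈ colorings α d ↔ content f = d := by
  rw [colorings, Finset.mem_filter, and_iff_right_iff_imp, Fintype.mem_piFinset]
  rintro rfl i
  exact mem_support_content f i

/-- The number of colorings with prescribed content that are constant on the cycles of `w`. -/
def invariantColorings {α : Type*} [Fintype α] (d : ℕ →₀ ℕ) (w : Equiv.Perm α) : ℕ :=
  ((colorings α d).filter fun f => f ∘ w = f).card

theorem content_row {n : ℕ} (lam : n.Partition) (h : Fin (rows lam).length → ℕ) :
    content (fun b : Box lam => h b.1) = ∑ i, Finsupp.single (h i) ((rows lam).blocksFun i) := by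
  rw [content, Fintype.sum_sigma]
  refine Finset.sum_congr rfl fun i _ => ?_
  simp

theorem sum_single_rows_apply {n : ℕ} (lam : n.Partition) {h : Fin (rows lam).length → ℕ}
    (hh : Function.Injective h) (i : Fin (rows lam).length) :
    (∑ i, Finsupp.single (h i) ((rows lam).blocksFun i)) (h i) = (rows lam).blocksFun i := by
  rw [Finsupp.finsetSum_apply, Finset.sum_eq_single i]
  · simp
  · intro j _ hj
    rw [Finsupp.single_apply, if_neg fun h1 => hj (hh h1)]
  · simp

theorem support_sum_single {n : ℕ} (lam : n.Partition) {h : Fin (rows lam).length → ℕ} :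
    (∑ i, Finsupp.single (h i) ((rows lam).blocksFun i)).support = Finset.univ.image h := by
  ext k
  rw [Finsupp.mem_support_iff, Finsupp.finsetSum_apply, Finset.mem_image, Ne,
    Finset.sum_eq_zero_iff]
  push Not
  simp only [Finset.mem_univ, true_and, Finsupp.single_apply]
  refine exists_congr fun i => ?_
  have := (rows lam).one_le_blocksFun i
  split_ifs with h1
  · simp [h1]; omega
  · simp [h1]

theorem exponents_sum_single {n : ℕ} (lam : n.Partition) {h : Fin (rows lam).length → ℕ}
    (hh : Function.Injective h) :
    (∑ i, Finsupp.single (h i) ((rows lam).blocksFun i)).support.val.map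
      ⇑(∑ i, Finsupp.single (h i) ((rows lam).blocksFun i) : ℕ →₀ ℕ) = lam.parts := by
  rw [support_sum_single, Finset.image_val_of_injOn hh.injOn, Multiset.map_map]
  conv_rhs => rw [← map_blocksFun_rows lam]
  refine Multiset.map_congr rfl fun i _ => ?_
  rw [Function.comp_apply]
  exact sum_single_rows_apply lam hh i

/-- Equal multisets of exponents can be matched by a bijection, which assigns to each row its own
variable. -/
theorem exists_eq_sum_single {n : ℕ} (lam : n.Partition) (d : ℕ →₀ ℕ)
    (hd : d.support.val.map d = lam.parts) : ∃ h : Fin (rows lam).length → ℕ,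
      Function.Injective h ∧ d = ∑ i, Finsupp.single (h i) ((rows lam).blocksFun i) := by
  obtain ⟨e, he⟩ := exists_equiv_of_map_eq (f := (rows lam).blocksFun)
    (g := fun k : d.support => d k) (by

      rw [map_blocksFun_rows, ← hd]
      exact (Multiset.attach_map_val' d.support.val d).symm)
  have hinj : Function.Injective fun i => (e i : ℕ) := Subtype.val_injective.comp e.injective
  refine ⟨fun i => e i, hinj, ?_⟩
  ext k
  by_cases hk : k ∈ d.support
  · obtain ⟨i, hi⟩ := e.surjective ⟨k, hk⟩
    have hk' : k = e i := by rw [hi]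
    rw [hk', sum_single_rows_apply lam hinj i, ← he]
    rfl
  · have h2 : k ∉ (∑ i, Finsupp.single (e i : ℕ) ((rows lam).blocksFun i)).support := by
      rw [support_sum_single lam (h := fun i => (e i : ℕ)), Finset.mem_image]
      rintro ⟨i, -, rfl⟩
      exact hk (e i).2
    rw [Finsupp.notMem_support_iff.1 hk, Finsupp.notMem_support_iff.1 h2]

theorem content_index {n : ℕ} (lam : n.Partition) (h : Fin (rows lam).length → ℕ) :
    content (fun j => h ((rows lam).index j)) =
      ∑ i, Finsupp.single (h i) ((rows lam).blocksFun i) := by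
  rw [← content_row, ← content_comp_equiv (rows lam).blocksFinEquiv]
  congr 1
  funext b
  exact congrArg h ((rows lam).index_embedding b.1 b.2)

/-- The Young subgroup is the stabilizer of a coloring `f₀` of content `d` that is constant on
blocks. Thus `x⁻¹ w x` lies in it iff `w` fixes `f₀ ∘ x⁻¹`, and each coloring of content `d` arises
from as many `x` as the subgroup has elements. The sign is invariant under conjugation and factors
out. -/
theorem inducedSign_eq {n : ℕ} (lam : n.Partition) (d : ℕ →₀ ℕ)
    (hd : d.support.val.map d = lam.parts) (w : Equiv.Perm (Fin n)) :
    inducedSign lam w = (Equiv.Perm.sign w : ℤ) * invariantColorings d w := by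
  obtain ⟨h, hh, hdh⟩ := exists_eq_sum_single lam d hd
  rw [← content_index] at hdh
  set f₀ : Fin n → ℕ := fun j => h ((rows lam).index j)
  have hY : ∀ x, x ∈ youngSubgroup lam ↔ f₀ ∘ x = f₀ := fun x => by
    rw [funext_iff]
    exact forall_congr' fun i => hh.eq_iff.symm
  have hconj : ∀ x : Equiv.Perm (Fin n), x⁻¹ * w * x ∈ youngSubgroup lam ↔
      (f₀ ∘ ⇑x⁻¹) ∘ w = f₀ ∘ ⇑x⁻¹ := fun x => by
    rw [hY]
    constructor
    · intro h1
      have h2 := congrArg (fun f : Fin n → ℕ => f ∘ ⇑(x⁻¹ : Equiv.Perm (Fin n))) h1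
      funext i
      simpa using congrFun h2 i
    · intro h1
      funext i
      simpa using congrFun h1 (x i)
  have hfib : ∀ f ∈ (colorings (Fin n) d).filter fun f => f ∘ w = f,
      (((Finset.univ : Finset (Equiv.Perm (Fin n))).filter
        fun x => x⁻¹ * w * x ∈ youngSubgroup lam).filter
          fun x : Equiv.Perm (Fin n) => f₀ ∘ ⇑x⁻¹ = f).card =
        Nat.card (youngSubgroup lam) := by
    intro f hf
    rw [Finset.mem_filter, mem_colorings, hdh] at hf
    obtain ⟨y, rfl⟩ := exists_equiv_of_content_eq hf.1
    have h0 : Nat.card (youngSubgroup lam) =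
        ((Finset.univ : Finset (Equiv.Perm (Fin n))).filter (· ∈ youngSubgroup lam)).card := by
      rw [Nat.card_eq_fintype_card, Fintype.card_subtype]
    rw [h0]
    -- With `f = f₀ ∘ y`, the fibre over `f` is the coset of `y⁻¹`.
    refine Finset.card_nbij' (fun x => y * x) (fun z => y⁻¹ * z) ?_ ?_ ?_ ?_
    · intro x hx
      simp only [Finset.coe_filter, Finset.mem_filter, Finset.mem_univ, true_and,
        Set.mem_ofPred_eq] at hx ⊢
      rw [hY]
      funext i
      simpa using (congrFun hx.2 (x i)).symm
    · intro z hz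
      simp only [Finset.coe_filter, Finset.mem_filter, Finset.mem_univ, true_and,
        Set.mem_ofPred_eq] at hz ⊢
      have h1 : f₀ ∘ ⇑(y⁻¹ * z)⁻¹ = f₀ ∘ y := by
        rw [hY] at hz
        funext i
        simpa using (congrFun hz (z⁻¹ (y i))).symm
      refine ⟨(hconj _).2 ?_, h1⟩
      rw [h1, hf.2]
    · intro x _; simp
    · intro z _; simp
  have hcount : ((Finset.univ : Finset (Equiv.Perm (Fin n))).filter
      fun x => x⁻¹ * w * x ∈ youngSubgroup lam).card =
      invariantColorings d w * Nat.card (youngSubgroup lam) := by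
    rw [Finset.card_eq_sum_card_fiberwise (f := fun x : Equiv.Perm (Fin n) => f₀ ∘ ⇑x⁻¹)
      (t := (colorings (Fin n) d).filter fun f => f ∘ w = f), Finset.sum_congr rfl hfib,
      Finset.sum_const, smul_eq_mul, invariantColorings]
    intro x hx
    simp only [Finset.coe_filter, Finset.mem_univ, true_and, Set.mem_ofPred_eq] at hx ⊢
    refine ⟨mem_colorings.2 ?_, (hconj x).1 hx⟩
    rw [content_comp_equiv, ← hdh]
  have hY0 : (Nat.card (youngSubgroup lam) : ℚ) ≠ 0 := by
    exact_mod_cast Nat.card_pos.ne'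
  rw [inducedSign, inducedFunction, ← Finset.sum_filter,
    Finset.sum_congr rfl (g := fun _ => ((Equiv.Perm.sign w : ℤ) : ℚ)), Finset.sum_const, hcount,
    nsmul_eq_mul]
  · push_cast
    field_simp
  · intro x _
    simp only [map_mul, map_inv]
    rw [mul_right_comm]
    simp

theorem evalAt_eq_sum {Γ : Type*} [Group Γ] [Fintype Γ] (θ : Γ → ℚ) (g : MonoidAlgebra ℚ Γ) :
    evalAt θ g = ∑ w, g.coeff w * θ w :=
  Finsupp.sum_fintype _ _ fun _ => zero_mul _

/-- The coefficients of `Y(g)`: up to sign, `Y` sends a permutation to a power sum. -/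
theorem symmGen_apply {n : ℕ} (g : MonoidAlgebra ℚ (Equiv.Perm (Fin n))) (d : ℕ →₀ ℕ) :
    symmGen g d =
      ∑ w, g.coeff w * ((Equiv.Perm.sign w : ℤ) * invariantColorings d w) := by
  have h1 : symmGen g d =
      ∑ lam : n.Partition, evalAt (inducedSign lam) g * monomialSymm lam d := by
    rw [← MvPowerSeries.coeff_apply (symmGen g) d, symmGen, map_sum]
    rfl
  rw [h1]
  by_cases hd : ∃ lam : n.Partition, d.support.val.map d = lam.parts
  · obtain ⟨lam, hlam⟩ := hd
    rw [Finset.sum_eq_single lam]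
    · simp only [monomialSymm, if_pos hlam, mul_one, evalAt_eq_sum, inducedSign_eq lam d hlam]
    · intro mu _ hne
      rw [monomialSymm, if_neg, mul_zero]
      intro h
      exact hne (Nat.Partition.ext (h.symm.trans hlam))
    · simp
  -- The nonzero exponents of any content form a partition of `n`, so for other `d` both sides
  -- vanish.
  · rw [Finset.sum_eq_zero, Finset.sum_eq_zero]
    · intro w _
      have : invariantColorings d w = 0 := by
        rw [invariantColorings, Finset.card_eq_zero, Finset.filter_eq_empty_iff]
        intro f hf
        rw [mem_colorings] at hf
        subst hf
        refine absurd ⟨⟨(content f).support.val.map (content f), ?_, ?_⟩, rfl⟩ hd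
        · intro i hi
          obtain ⟨k, hk, rfl⟩ := Multiset.mem_map.1 hi
          exact Nat.pos_of_ne_zero (Finsupp.mem_support_iff.1 hk)
        · rw [sum_content, Fintype.card_fin]
      simp [this]
    · intro lam _
      rw [monomialSymm, if_neg fun h => hd ⟨lam, h⟩, mul_zero]

/-! ### Linear independence of power sums -/

/-- The cycle type of a permutation, counting fixed points. -/
def permType {n : ℕ} (w : Equiv.Perm (Fin n)) : n.Partition :=
  ⟨w.partition.parts, w.partition.parts_pos, by rw [w.partition.parts_sum, Fintype.card_fin]⟩

theorem parts_permType {n : ℕ} (w : Equiv.Perm (Fin n)) : w.partition.parts = (permType w).parts :=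
  rfl

theorem eq_row_of_comp_rowPerm {α : Type*} {n : ℕ} {lam : n.Partition} (U : PTableau α lam)
    {f : α → ℕ} (hf : f ∘ rowPerm U = f) :
    ∃ h : Fin (rows lam).length → ℕ, f ∘ U = fun b => h b.1 := by
  refine ⟨fun i => f (U ⟨i, ⟨0, (rows lam).one_le_blocksFun i⟩⟩), ?_⟩
  funext ⟨i, j⟩
  obtain ⟨j, hj⟩ := j
  induction j with
  | zero => rfl
  | succ j ih =>
    have hj' : j < (rows lam).blocksFun i := by omega
    rw [← ih hj']
    have h1 := congrFun hf (U ⟨i, ⟨j, hj'⟩⟩)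
    rw [Function.comp_apply, rowPerm_apply, rotateRows_mk] at h1
    have h2 : finRotate _ (⟨j, hj'⟩ : Fin ((rows lam).blocksFun i)) = ⟨j + 1, hj⟩ := by
      ext; rw [finRotate_val]; exact Nat.mod_eq_of_lt hj
    rw [h2] at h1
    exact h1

theorem card_parts_eq_length {n : ℕ} (lam : n.Partition) :
    lam.parts.card = (rows lam).length := by
  rw [← map_blocksFun_rows lam, Multiset.card_map]
  simp

/-- A coloring that is constant on cycles uses at most as many colors as there are cycles; in case
of equality, the multiplicities of the colors are the lengths of the cycles. -/
theorem permType_of_invariantColorings_ne_zero {n : ℕ} (lam : n.Partition) (d : ℕ →₀ ℕ)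
    (hd : d.support.val.map d = lam.parts) (w : Equiv.Perm (Fin n))
    (hw : invariantColorings d w ≠ 0) :
    lam.parts.card ≤ (permType w).parts.card ∧
      (lam.parts.card = (permType w).parts.card → permType w = lam) := by
  obtain ⟨f, hf⟩ := Finset.card_ne_zero.1 hw
  rw [Finset.mem_filter, mem_colorings] at hf
  obtain ⟨rfl, hfw⟩ := hf
  obtain ⟨U, hU⟩ := (exists_rowPerm_eq_iff (Fintype.card_fin n) (permType w) w).2
    (parts_permType w)
  rw [← hU] at hfw
  obtain ⟨h, hh⟩ := eq_row_of_comp_rowPerm U hfw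
  have hc : content f = ∑ i, Finsupp.single (h i) ((rows (permType w)).blocksFun i) := by
    rw [← content_row, ← hh, content_comp_equiv]
  have hcard : lam.parts.card = (Finset.univ.image h).card := by
    rw [← support_sum_single (permType w), ← hc, ← hd, Multiset.card_map]
    rfl
  have hle : (Finset.univ.image h).card ≤ _ := Finset.card_image_le
  rw [Finset.card_univ, Fintype.card_fin] at hle
  rw [card_parts_eq_length (permType w), hcard]
  refine ⟨hle, fun heq' => ?_⟩
  have hinj : Function.Injective h := by
    rw [← Set.injOn_univ, ← Finset.coe_univ, ← Finset.card_image_iff, heq',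
      Finset.card_univ, Fintype.card_fin]
  ext1
  rw [← hd, hc, exponents_sum_single _ hinj]

theorem invariantColorings_conj {n : ℕ} (d : ℕ →₀ ℕ) (c w : Equiv.Perm (Fin n)) :
    invariantColorings d (c * w * c⁻¹) = invariantColorings d w := by
  refine Finset.card_nbij' (fun f => f ∘ c) (fun f => f ∘ ⇑c⁻¹) ?_ ?_ ?_ ?_
  · intro f hf
    simp only [Finset.coe_filter, Set.mem_ofPred_eq, mem_colorings] at hf ⊢
    rw [content_comp_equiv]
    refine ⟨hf.1, funext fun i => ?_⟩
    simpa using congrFun hf.2 (c i)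
  · intro f hf
    simp only [Finset.coe_filter, Set.mem_ofPred_eq, mem_colorings] at hf ⊢
    rw [content_comp_equiv]
    refine ⟨hf.1, funext fun i => ?_⟩
    simpa using congrFun hf.2 (c⁻¹ i)
  · intro f _; funext i; simp
  · intro f _; funext i; simp

theorem isConj_of_permType_eq {n : ℕ} {w w' : Equiv.Perm (Fin n)} (h : permType w = permType w') :
    ∃ c, c * w * c⁻¹ = w' := by
  refine isConj_iff.1 (Equiv.Perm.isConj_iff_cycleType_eq.2 ?_)
  rw [← Equiv.Perm.filter_parts_partition_eq_cycleType,
    ← Equiv.Perm.filter_parts_partition_eq_cycleType, parts_permType, parts_permType, h]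

/-- Give each cycle of `w` its own color, with the colors chosen so that the content is `d`. -/
theorem invariantColorings_ne_zero {n : ℕ} (lam : n.Partition) {w : Equiv.Perm (Fin n)}
    (hw : permType w = lam) {d : ℕ →₀ ℕ} (hd : d.support.val.map d = lam.parts) :
    invariantColorings d w ≠ 0 := by
  obtain ⟨U, hU⟩ := (exists_rowPerm_eq_iff (Fintype.card_fin n) lam w).2
    (by rw [parts_permType, hw])
  obtain ⟨h, -, hdh⟩ := exists_eq_sum_single lam d hd
  refine Finset.card_ne_zero.2 ⟨fun a => h (U.symm a).1, ?_⟩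
  rw [Finset.mem_filter, mem_colorings, hdh, ← content_row]
  refine ⟨content_comp_equiv U.symm (fun b : Box lam => h b.1), funext fun a => ?_⟩
  obtain ⟨b, rfl⟩ := U.surjective a
  rw [← hU, Function.comp_apply, rowPerm_apply]
  simp [rotateRows]

/-- Distinct power sums are linearly independent. -/
theorem sum_permType_eq_zero {n : ℕ} (a : Equiv.Perm (Fin n) → ℚ)
    (ha : ∀ d : ℕ →₀ ℕ, ∑ w, a w * ((Equiv.Perm.sign w : ℤ) * invariantColorings d w) = 0)
    (lam : n.Partition) : ∑ w with permType w = lam, a w = 0 := by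
  by_contra hne
  -- Among the types with nonzero class sum, `mu` has the most parts. A monomial with exponents `mu`
  -- occurs in the power sum of `nu` only if `nu` has more parts than `mu` or equals `mu`, so in the
  -- coefficient at `d` only `mu` survives.
  obtain ⟨mu, hmu, hmax⟩ := Finset.exists_max_image
    (Finset.univ.filter fun mu : n.Partition => ∑ w with permType w = mu, a w ≠ 0)
    (fun mu => mu.parts.card) ⟨lam, by simpa using hne⟩
  rw [Finset.mem_filter] at hmu
  set d : ℕ →₀ ℕ := ∑ i, Finsupp.single (Fin.val i) ((rows mu).blocksFun i)
  have hd : d.support.val.map d = mu.parts := exponents_sum_single mu Fin.val_injective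
  have h0 := ha d
  -- The sign and the number of invariant colorings are constant on conjugacy classes.
  have hclass : ∀ nu : n.Partition, ∃ t : ℚ, (∀ w, permType w = nu →
      ((Equiv.Perm.sign w : ℤ) * invariantColorings d w : ℚ) = t) := by
    intro nu
    by_cases hnu : ∃ w₀ : Equiv.Perm (Fin n), permType w₀ = nu
    · obtain ⟨w₀, hw₀⟩ := hnu
      refine ⟨(Equiv.Perm.sign w₀ : ℤ) * invariantColorings d w₀, fun w hw => ?_⟩
      obtain ⟨c, rfl⟩ := isConj_of_permType_eq (hw₀.trans hw.symm)
      rw [invariantColorings_conj]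
      rw [map_mul, map_mul, map_inv, mul_right_comm, mul_inv_cancel, one_mul]
    · exact ⟨0, fun w hw => absurd ⟨w, hw⟩ hnu⟩
  choose t ht using hclass
  rw [← Finset.sum_fiberwise Finset.univ permType, Finset.sum_eq_single mu] at h0
  · rw [Finset.sum_congr rfl (g := fun w => a w * t mu)
      (fun w hw => by rw [ht mu w (Finset.mem_filter.1 hw).2]), ← Finset.sum_mul] at h0
    rcases mul_eq_zero.1 h0 with h1 | h1
    · exact hmu.2 h1
    · obtain ⟨w, hw, -⟩ := Finset.exists_ne_zero_of_sum_ne_zero hmu.2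
      have h2 := ht mu w (Finset.mem_filter.1 hw).2
      have h3 := invariantColorings_ne_zero mu (Finset.mem_filter.1 hw).2 hd
      rw [h1] at h2
      simp [h3] at h2
  · intro nu _ hnu
    rw [Finset.sum_congr rfl (g := fun w => a w * t nu)
      (fun w hw => by rw [ht nu w (Finset.mem_filter.1 hw).2]), ← Finset.sum_mul]
    by_contra h1
    obtain ⟨h2, h3⟩ := not_or.1 (mul_eq_zero.not.1 h1)
    obtain ⟨w, hw, -⟩ := Finset.exists_ne_zero_of_sum_ne_zero h2
    have hwn := (Finset.mem_filter.1 hw).2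
    have h4 : invariantColorings d w ≠ 0 := by
      intro h5
      rw [← ht nu w hwn, h5] at h3
      simp at h3
    obtain ⟨h5, h6⟩ := permType_of_invariantColorings_ne_zero mu d hd w h4
    rw [hwn] at h5 h6
    exact hnu (h6 (le_antisymm h5 (hmax nu (by simpa using h2))))
  · simp

theorem evalAt_powerSumTrace {n : ℕ} (lam : n.Partition)
    (g : MonoidAlgebra ℚ (Equiv.Perm (Fin n))) :
    evalAt (powerSumTrace lam) g = zCoeff lam * ∑ w with permType w = lam, g.coeff w := by
  rw [evalAt_eq_sum, Finset.mul_sum, Finset.sum_filter]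
  refine Finset.sum_congr rfl fun w _ => ?_
  simp only [powerSumTrace, parts_permType, ← Nat.Partition.ext_iff]
  split_ifs <;> ring

/-- The power sum traces of `g` depend only on `Y(g)`. -/
theorem evalAt_powerSumTrace_congr {n : ℕ} (lam : n.Partition)
    {g g' : MonoidAlgebra ℚ (Equiv.Perm (Fin n))} (h : symmGen g = symmGen g') :
    evalAt (powerSumTrace lam) g = evalAt (powerSumTrace lam) g' := by
  rw [evalAt_powerSumTrace, evalAt_powerSumTrace]
  congr 1
  rw [← sub_eq_zero, ← Finset.sum_sub_distrib]
  refine sum_permType_eq_zero (fun w => g.coeff w - g'.coeff w) (fun d => ?_) lam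
  simp only [sub_mul, Finset.sum_sub_distrib]
  rw [← symmGen_apply, ← symmGen_apply, h, sub_self]

/-! ### The element with `Y(g) = X_{inc(P)}` and its power sum traces -/

/-- The sum of the permutations that never send an element to a smaller one. -/
def ngrElement {P : Type*} [Fintype P] [PartialOrder P] {n : ℕ} (e : P ≃ Fin n) :
    MonoidAlgebra ℚ (Equiv.Perm (Fin n)) :=
  .ofCoeff (Finsupp.equivFunOnFinite.symm fun w => if IsNgrPerm (e.symm.permCongr w) then 1 else 0)

theorem sum_ngrElement {P : Type*} [Fintype P] [PartialOrder P] {n : ℕ} (e : P ≃ Fin n)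
    (θ : Equiv.Perm (Fin n) → ℚ) :
    ∑ w, (ngrElement e).coeff w * θ w =
      ∑ σ : Equiv.Perm P with IsNgrPerm σ, θ (e.permCongr σ) := by
  rw [← Equiv.sum_comp e.permCongr, Finset.sum_filter]
  refine Finset.sum_congr rfl fun σ _ => ?_
  have : e.symm.permCongr (e.permCongr σ) = σ := by ext; simp
  simp [ngrElement, this]

theorem invariantColorings_permCongr {α β : Type*} [Fintype α] [Fintype β] (e : α ≃ β)
    (d : ℕ →₀ ℕ) (σ : Equiv.Perm α) :
    invariantColorings d (e.permCongr σ) = invariantColorings d σ := by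
  refine Finset.card_nbij' (fun f => f ∘ e) (fun f => f ∘ e.symm) ?_ ?_ ?_ ?_
  · intro f hf
    simp only [Finset.coe_filter, Set.mem_ofPred_eq, mem_colorings] at hf ⊢
    rw [content_comp_equiv]
    refine ⟨hf.1, funext fun i => ?_⟩
    simpa using congrFun hf.2 (e i)
  · intro f hf
    simp only [Finset.coe_filter, Set.mem_ofPred_eq, mem_colorings] at hf ⊢
    rw [content_comp_equiv]
    refine ⟨hf.1, funext fun i => ?_⟩
    simpa using congrFun hf.2 (e.symm i)
  · intro f _; funext i; simp
  · intro f _; funext i; simp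

theorem chromaticSymm_apply {P : Type*} [Fintype P] [PartialOrder P] (d : ℕ →₀ ℕ) :
    chromaticSymm (incGraph P) d = ∑ κ ∈ colorings P d,
      if ∀ a b, κ a = κ b → a ≤ b ∨ b ≤ a then (1 : ℚ) else 0 := by
  rw [← Finset.sum_filter, Finset.sum_const, nsmul_eq_mul, mul_one, chromaticSymm,
    ← Nat.card_eq_finsetCard]
  congr 1
  have hiff : ∀ κ : P → ℕ, (∀ {a b}, (incGraph P).Adj a b → κ a ≠ κ b) ↔
      ∀ a b, κ a = κ b → a ≤ b ∨ b ≤ a := fun κ => by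
    refine forall₂_congr fun a b => ?_
    simp only [incGraph, IncompRel, Ne]
    tauto
  refine Nat.card_congr ⟨fun κ => ⟨κ.1, ?_⟩, fun κ => ⟨SimpleGraph.Coloring.mk κ.1 ?_, ?_⟩, ?_, ?_⟩
  · rw [Finset.mem_filter, mem_colorings, ← hiff]
    exact ⟨κ.2, fun h => κ.1.valid h⟩
  · exact (hiff κ.1).2 (Finset.mem_filter.1 κ.2).2
  · exact mem_colorings.1 (Finset.mem_filter.1 κ.2).1
  · intro κ; rfl
  · intro κ; rfl

/-- Exchange the sums over permutations and colorings, and evaluate the sum over permutations by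
`sign_sum_eq`. -/
theorem symmGen_ngrElement {P : Type*} [Fintype P] [PartialOrder P] {n : ℕ} (e : P ≃ Fin n) :
    symmGen (ngrElement e) = chromaticSymm (incGraph P) := by
  funext d
  rw [symmGen_apply, sum_ngrElement, chromaticSymm_apply]
  simp only [invariantColorings_permCongr, Equiv.Perm.sign_permCongr]
  have hκ : ∀ κ : P → ℕ, (if ∀ a b, κ a = κ b → a ≤ b ∨ b ≤ a then (1 : ℚ) else 0) =
      ∑ σ : Equiv.Perm P with IsNgrPerm σ ∧ ∀ a, κ (σ a) = κ a,
        ((Equiv.Perm.sign σ : ℤ) : ℚ) := fun κ => by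
    convert (sign_sum_eq κ).symm
  simp only [hκ]
  simp only [Finset.sum_filter]
  rw [Finset.sum_comm]
  refine Finset.sum_congr rfl fun σ _ => ?_
  rw [invariantColorings, Finset.card_filter]
  split_ifs with h
  · push_cast
    rw [Finset.mul_sum]
    refine Finset.sum_congr rfl fun κ _ => ?_
    simp only [h, true_and, mul_ite, mul_one, mul_zero]
    congr 1
    exact propext funext_iff
  · simp [h]

theorem evalAt_ngrElement {P : Type*} [Fintype P] [PartialOrder P] {n : ℕ} (e : P ≃ Fin n)
    (lam : n.Partition) : evalAt (powerSumTrace lam) (ngrElement e) =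
      {U : PTableau P lam | CyclicallyRowSemistrict U}.ncard := by
  have hn : Fintype.card P = n := by rw [Fintype.card_congr e, Fintype.card_fin]
  rw [evalAt_eq_sum, sum_ngrElement, ncard_cyclicallyRowSemistrict hn]
  push_cast
  refine Finset.sum_congr rfl fun σ _ => ?_
  rw [powerSumTrace]
  have : (e.permCongr σ).partition.parts = lam.parts ↔ σ.partition.parts = lam.parts := by
    rw [← exists_rowPerm_eq_iff hn, ← exists_rowPerm_eq_iff (Fintype.card_fin n)]
    constructor
    · rintro ⟨U, hU⟩
      refine ⟨U.trans e.symm, Equiv.ext fun a => ?_⟩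
      have := DFunLike.congr_fun hU (e a)
      simp only [rowPerm, Equiv.permCongr_apply] at this ⊢
      simp [this]
    · rintro ⟨U, rfl⟩
      exact ⟨U.trans e, Equiv.ext fun a => by simp [rowPerm]⟩
  simp only [this]

/-! ### Semistrict words and acyclic orientations -/

/-- Reachability is a partial order by acyclicity, and it extends to a linear order. -/
theorem exists_linear_extension {m : ℕ} {Q : Type*} [Fintype Q]
    (hm : Fintype.card Q = m) {O : Digraph Q} (hO : IsAcyclicDigraph O) :
    ∃ e : Fin m ≃ Q, ∀ a b, O.Adj a b → e.symm a < e.symm b := by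
  have : IsPartialOrder Q (Relation.ReflTransGen O.Adj) :=
    { refl := fun a => .refl
      trans := fun a b c => .trans
      antisymm := fun a b hab hba => by
        rcases Relation.reflTransGen_iff_eq_or_transGen.1 hab with h | h
        · exact h.symm
        · exact absurd (h.trans_left hba) (hO a) }
  obtain ⟨s, hs, hle⟩ := extend_partialOrder (Relation.ReflTransGen O.Adj)
  let L : LinearOrder Q :=
    { le := s
      le_refl := hs.refl
      le_trans := hs.trans
      le_antisymm := hs.antisymm
      le_total := hs.total
      toDecidableLE := Classical.decRel _ }
  let e : Fin m ≃o Q := Fintype.orderIsoFinOfCardEq Q hm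
  refine ⟨e.toEquiv, fun a b hab => ?_⟩
  have h1 : e.symm a ≤ e.symm b := e.symm.monotone (hle _ _ (.single hab))
  refine lt_of_le_of_ne h1 fun h2 => ?_
  have h3 := e.symm.injective h2
  subst h3
  exact hO a (.single hab)

section Words

variable {Q : Type*} [PartialOrder Q] {m : ℕ}

/-- No letter is greater than the next one. -/
def IsSemistrictWord (u : Fin m → Q) : Prop :=
  ∀ j k : Fin m, (k : ℕ) = j + 1 → ¬ u j > u k

/-- No letter is greater than the cyclically next one. -/
def IsCyclicWord (u : Fin m → Q) : Prop :=
  IsSemistrictWord u ∧ ∀ j k : Fin m, (j : ℕ) = 0 → (k : ℕ) + 1 = m → ¬ u k > u j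

/-- No letter but the first one is greater than all the previous letters. -/
def IsRecordFreeWord (u : Fin m → Q) : Prop :=
  ∀ t : Fin m, (∀ k < t, u k < u t) → (t : ℕ) = 0

theorem lt_or_gt_of_not_incompRel {a b : Q} (h : ¬ IncompRel (· ≤ ·) a b) (hne : a ≠ b) :
    a < b ∨ b < a := by
  simp only [IncompRel, not_and_or, not_not] at h
  exact h.imp (fun h => lt_of_le_of_ne h hne) (fun h => lt_of_le_of_ne h hne.symm)

/-- Move left from `t`: if `u (s + 1) < u t` but `u t < u s`, then `u s > u (s + 1)`, contrary to
semistrictness. -/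
theorem lt_of_comparable {u : Fin m → Q} (hu : IsSemistrictWord u) (hinj : Function.Injective u)
    {i t : Fin m} (h : ∀ s, i ≤ s → s < t → ¬ IncompRel (· ≤ ·) (u s) (u t)) :
    ∀ s, i ≤ s → s < t → u s < u t := by
  have key : ∀ (k : ℕ) (s : Fin m), i ≤ s → (s : ℕ) + k + 1 = t → u s < u t := by
    intro k
    induction k with
    | zero =>
      intro s his hst
      have hlt : s < t := by rw [Fin.lt_def]; omega
      exact (lt_or_gt_of_not_incompRel (h s his hlt) (hinj.ne hlt.ne)).resolve_right
        (hu s t (by omega))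
    | succ k ih =>
      intro s his hst
      have hlt : s < t := by rw [Fin.lt_def]; omega
      refine (lt_or_gt_of_not_incompRel (h s his hlt) (hinj.ne hlt.ne)).resolve_right fun h1 => ?_
      have hs' : (s : ℕ) + 1 < m := by omega
      have h2 := ih ⟨s + 1, hs'⟩ (by rw [Fin.le_def] at his ⊢; simp; omega) (by simp; omega)
      exact hu s ⟨s + 1, hs'⟩ rfl (h2.trans h1)
  intro s his hst
  refine key (t - s - 1) s his ?_
  rw [Fin.lt_def] at hst
  omega

/-- The orientation of the incomparability graph given by the order of the letters of a word. -/
def wordDigraph (e : Fin m ≃ Q) : Digraph Q where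
  Adj a b := IncompRel (· ≤ ·) a b ∧ e.symm a < e.symm b

theorem isOrientation_wordDigraph (e : Fin m ≃ Q) :
    IsOrientation (incGraph Q) (wordDigraph e) := by
  refine ⟨fun a b h => h.1, fun a b (h : IncompRel (· ≤ ·) a b) => ?_⟩
  have hne : e.symm a ≠ e.symm b := fun h1 => by
    rw [e.symm.injective h1] at h
    exact h.1 le_rfl
  rcases hne.lt_or_gt with h1 | h1
  · exact Or.inl ⟨⟨h, h1⟩, fun h2 => h1.asymm h2.2⟩
  · exact Or.inr ⟨⟨h.symm, h1⟩, fun h2 => h1.asymm h2.2⟩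

theorem isAcyclic_wordDigraph (e : Fin m ≃ Q) : IsAcyclicDigraph (wordDigraph e) := by
  have h : ∀ a b, Relation.TransGen (wordDigraph e).Adj a b → e.symm a < e.symm b := by
    intro a b hab
    induction hab with
    | single h => exact h.2
    | tail _ h ih => exact ih.trans h.2
  exact fun a ha => (h a a ha).false

/-- At the first difference `i`, the letter `e' i` occurs in `e` at some later `t`. The letters of
`e` in positions from `i` up to `t` precede `e' i` in `e` but not in `e'`, so they are comparable to
it, and `lt_of_comparable` gives `e i < e' i`. By symmetry `e' i < e i`. -/
theorem wordDigraph_injective {e e' : Fin m ≃ Q} (he : IsSemistrictWord e)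
    (he' : IsSemistrictWord e') (h : wordDigraph e = wordDigraph e') : e = e' := by
  have hadj : ∀ a b, IncompRel (· ≤ ·) a b → e.symm a < e.symm b → e'.symm a < e'.symm b :=
    fun a b hab h1 => by
      have h2 : (wordDigraph e).Adj a b := ⟨hab, h1⟩
      rw [h] at h2
      exact h2.2
  have hlt : ∀ {f f' : Fin m ≃ Q}, IsSemistrictWord f →
      (∀ a b, IncompRel (· ≤ ·) a b → f.symm a < f.symm b → f'.symm a < f'.symm b) →
      ∀ i : Fin m, (∀ k < i, f k = f' k) → f i ≠ f' i → f i < f' i := by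
    intro f f' hf hff i hi hne
    have hpos : ∀ s, i ≤ s → i ≤ f'.symm (f s) := fun s hs => by
      by_contra h1
      rw [not_le] at h1
      have h2 := hi _ h1
      rw [Equiv.apply_symm_apply] at h2
      rw [f.injective h2] at h1
      exact hs.not_gt h1
    set t := f.symm (f' i) with ht
    have hft : f t = f' i := by simp [ht]
    have hit : i < t := by
      by_contra h1
      rw [not_lt] at h1
      rcases h1.lt_or_eq with h2 | h2
      · have h3 := hi _ h2
        rw [hft] at h3
        exact h2.ne' (f'.injective h3)
      · rw [h2] at hft
        exact hne hft
    rw [← hft]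
    refine lt_of_comparable hf f.injective (i := i) (fun s his hst hinc => ?_) i le_rfl hit
    have h1 := hff _ _ hinc (by simpa using hst)
    rw [hft, Equiv.symm_apply_apply] at h1
    exact (hpos s his).not_gt h1
  have hadj' : ∀ a b, IncompRel (· ≤ ·) a b → e'.symm a < e'.symm b → e.symm a < e.symm b :=
    fun a b hab h1 => by
      have h2 : (wordDigraph e').Adj a b := ⟨hab, h1⟩
      rw [← h] at h2
      exact h2.2
  ext i
  induction i using WellFoundedLT.induction with
  | ind i ih =>
    by_contra hne
    exact (hlt he hadj i ih hne).asymm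
      (hlt he' hadj' i (fun k hk => (ih k hk).symm) (Ne.symm hne))

/-- Choose the linear extension maximizing `∑ i · ρ (e i)` with `ρ` strictly monotone. Swapping an
adjacent descent would increase this sum, and it breaks no edge since the two letters are
comparable. -/
theorem exists_semistrict_extension [Fintype Q] (hm : Fintype.card Q = m) {O : Digraph Q}
    (hO : IsAcyclicDigraph O) (hinc : ∀ a b, O.Adj a b → IncompRel (· ≤ ·) a b) :
    ∃ e : Fin m ≃ Q, IsSemistrictWord e ∧ ∀ a b, O.Adj a b → e.symm a < e.symm b := by
  obtain ⟨e₀, he₀⟩ := exists_linear_extension hm hO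
  let ρ : Q → ℤ := fun a => ((Finset.univ.filter (· ≤ a)).card : ℤ)
  have hρ : ∀ a b, a < b → ρ a < ρ b := fun a b hab => by
    refine Int.ofNat_lt.2 (Finset.card_lt_card ⟨fun x hx => ?_, fun h => ?_⟩)
    · rw [Finset.mem_filter] at hx ⊢
      exact ⟨hx.1, hx.2.trans hab.le⟩
    · have := h (Finset.mem_filter.2 ⟨Finset.mem_univ b, le_rfl⟩)
      exact hab.not_ge (Finset.mem_filter.1 this).2
  obtain ⟨e, he, hmax⟩ := Finset.exists_max_image
    (Finset.univ.filter fun e : Fin m ≃ Q => ∀ a b, O.Adj a b → e.symm a < e.symm b)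
    (fun e => ∑ i : Fin m, ((i : ℕ) : ℤ) * ρ (e i)) ⟨e₀, by simpa using he₀⟩
  rw [Finset.mem_filter] at he
  refine ⟨e, fun j k hjk hgt => ?_, he.2⟩
  have hne : j ≠ k := fun h => by rw [h] at hjk; omega
  have hmem : (Equiv.swap j k).trans e ∈
      Finset.univ.filter fun e : Fin m ≃ Q => ∀ a b, O.Adj a b → e.symm a < e.symm b := by
    rw [Finset.mem_filter]
    refine ⟨Finset.mem_univ _, fun a b hab => ?_⟩
    have h1 := he.2 a b hab
    have h2 : ¬ (e.symm a = j ∧ e.symm b = k) := by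
      rintro ⟨rfl, rfl⟩
      simp only [Equiv.apply_symm_apply] at hgt
      exact (hinc a b hab).2 hgt.le
    simp only [Equiv.symm_trans_apply, Equiv.symm_swap, Equiv.swap_apply_def]
    generalize e.symm a = p at *
    generalize e.symm b = q at *
    rw [Fin.lt_def] at h1 ⊢
    simp only [Fin.ext_iff] at *
    split_ifs <;> omega
  have h1 := hmax _ hmem
  have h2 : ∑ i : Fin m, ((i : ℕ) : ℤ) * ρ ((Equiv.swap j k).trans e i) =
      ∑ i : Fin m, ((Equiv.swap j k i : ℕ) : ℤ) * ρ (e i) := by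
    rw [← Equiv.sum_comp (Equiv.swap j k)]
    simp
  rw [h2, ← sub_nonpos, ← Finset.sum_sub_distrib, Fintype.sum_eq_add j k hne] at h1
  · have h3 := hρ _ _ hgt
    rw [Equiv.swap_apply_left, Equiv.swap_apply_right, hjk] at h1
    push_cast at h1
    linarith
  · rintro i ⟨hi, hi'⟩
    rw [Equiv.swap_apply_of_ne_of_ne hi hi', sub_self]

/-- A source is comparable to all letters on its left, hence by semistrictness greater than them:
sources are the records. -/
theorem isSource_wordDigraph_iff {e : Fin m ≃ Q} (he : IsSemistrictWord e) (t : Fin m) :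
    IsSource (wordDigraph e) (e t) ↔ ∀ k < t, e k < e t := by
  constructor
  · intro h k hk
    refine lt_of_comparable he e.injective (i := ⟨0, t.pos⟩) (fun s _ hs hinc => ?_) k
      (Nat.zero_le _) hk
    exact h (e s) ⟨hinc, by simpa using hs⟩
  · rintro h a ⟨h1, h2⟩
    rw [Equiv.symm_apply_apply] at h2
    have h3 := h _ h2
    rw [Equiv.apply_symm_apply] at h3
    exact h1.1 h3.le

theorem existsUnique_isSource_wordDigraph_iff (hm : 0 < m) {e : Fin m ≃ Q}
    (he : IsSemistrictWord e) :
    (∃! v, IsSource (wordDigraph e) v) ↔ IsRecordFreeWord e := by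
  have h0 : IsSource (wordDigraph e) (e ⟨0, hm⟩) :=
    (isSource_wordDigraph_iff he _).2 fun k hk => absurd hk (Nat.not_lt_zero _)
  constructor
  · intro h t ht
    have h1 := h.unique ((isSource_wordDigraph_iff he t).2 ht) h0
    rw [e.injective h1]
  · refine fun h => ⟨_, h0, fun v hv => ?_⟩
    obtain ⟨t, rfl⟩ := e.surjective v
    congr 1
    ext
    exact h t ((isSource_wordDigraph_iff he t).1 hv)

/-- The acyclic orientations with one source correspond to the record-free semistrict words. -/
theorem card_recordFree_eq [Fintype Q] (hm : Fintype.card Q = m) (hpos : 0 < m) :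
    Nat.card {e : Fin m ≃ Q // IsRecordFreeWord e ∧ IsSemistrictWord e} =
      Nat.card {O : Digraph Q // IsOrientation (incGraph Q) O ∧ IsAcyclicDigraph O ∧
        ∃! v, IsSource O v} := by
  refine Nat.card_congr (Equiv.ofBijective (fun e => ⟨wordDigraph e.1,
    isOrientation_wordDigraph e.1, isAcyclic_wordDigraph e.1,
    (existsUnique_isSource_wordDigraph_iff hpos e.2.2).2 e.2.1⟩) ⟨?_, ?_⟩)
  · intro e e' h
    exact Subtype.ext (wordDigraph_injective e.2.2 e'.2.2 (congrArg Subtype.val h))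
  · rintro ⟨O, hO, hac, hs⟩
    obtain ⟨e, he, hext⟩ := exists_semistrict_extension hm hac hO.1
    have heq : wordDigraph e = O := by
      ext a b
      refine ⟨fun h => ?_, fun h => ⟨hO.1 a b h, hext a b h⟩⟩
      rcases (hO.2 a b h.1).or with h1 | h1
      · exact h1
      · exact absurd h.2 (hext b a h1).asymm
    subst heq
    exact ⟨⟨e, (existsUnique_isSource_wordDigraph_iff hpos he).1 hs, he⟩, rfl⟩

end Words

/-! ### The recursion for cycles -/

theorem mul_apply_of_supports {P : Type*} {T : Finset P} {τ ρ : Equiv.Perm P}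
    (hτ : ∀ a ∉ T, τ a = a) (hρ : ∀ a ∈ T, ρ a = a) (a : P) :
    (τ * ρ) a = if a ∈ T then τ a else ρ a := by
  rw [Equiv.Perm.mul_apply]
  split_ifs with h
  · rw [hρ a h]
  · refine hτ _ fun h1 => h ?_
    have := ρ.injective (hρ _ h1)
    rwa [this] at h1

theorem sameCycle_mul_iff {P : Type*} [Finite P] {T : Finset P} {τ ρ : Equiv.Perm P}
    (hcyc : τ.IsCycleOn T) (hτ : ∀ a ∉ T, τ a = a) (hρ : ∀ a ∈ T, ρ a = a) {v : P} (hv : v ∈ T) (y : P) :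
    (τ * ρ).SameCycle v y ↔ y ∈ T := by
  have hpow : ∀ k : ℕ, ((τ * ρ) ^ k) v = (τ ^ k) v ∧ (τ ^ k) v ∈ T := by
    intro k
    induction k with
    | zero => simpa using hv
    | succ k ih =>
      rw [pow_succ', pow_succ', Equiv.Perm.mul_apply, ih.1, mul_apply_of_supports hτ hρ,
        if_pos ih.2, Equiv.Perm.mul_apply]
      exact ⟨rfl, hcyc.apply_mem_iff.2 ih.2⟩
  constructor
  · intro h
    obtain ⟨k, rfl⟩ := h.exists_nat_pow_eq
    rw [(hpow k).1]
    exact (hpow k).2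
  · intro h
    obtain ⟨k, -, rfl⟩ := hcyc.exists_pow_eq hv h
    exact ⟨k, by rw [zpow_natCast, (hpow k).1]⟩

section Recursion

variable {P : Type*} [Fintype P] [PartialOrder P]

/-- Any two elements are comparable. -/
def PairwiseComparable (S : Finset P) : Prop := ∀ a ∈ S, ∀ b ∈ S, a ≤ b ∨ b ≤ a

/-- The permutations supported on `S` that never send an element to a smaller one. -/
def ngrPermsOn (S : Finset P) : Finset (Equiv.Perm P) :=
  Finset.univ.filter fun σ => IsNgrPerm σ ∧ ∀ a ∉ S, σ a = a

/-- The permutations that are a cycle on `T`, fix the other elements, and never send an element to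
a smaller one. -/
def ngrCyclesOn (T : Finset P) : Finset (Equiv.Perm P) :=
  Finset.univ.filter fun σ => σ.IsCycleOn T ∧ IsNgrPerm σ ∧ ∀ a ∉ T, σ a = a

theorem sum_sign_ngrPermsOn (S : Finset P) :
    ∑ σ ∈ ngrPermsOn S, ((Equiv.Perm.sign σ : ℤ) : ℚ) = if PairwiseComparable S then 1 else 0 := by
  -- One color for all of `S` and a private color for every other element: preserving `κ` means
  -- fixing the complement of `S` pointwise.
  let κ : P → Option P := fun a => if a ∈ S then none else some a
  have hκ : ∀ a b, κ a = κ b ↔ (a ∈ S ∧ b ∈ S) ∨ a = b := fun a b => by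
    simp only [κ]
    split_ifs with h1 h2 h2 <;> simp_all <;> rintro rfl <;> contradiction
  have h2 : (∀ a b, κ a = κ b → a ≤ b ∨ b ≤ a) ↔ PairwiseComparable S := by
    refine ⟨fun h a ha b hb => h a b ((hκ a b).2 (Or.inl ⟨ha, hb⟩)), fun h a b hab => ?_⟩
    rcases (hκ a b).1 hab with h3 | rfl
    · exact h a h3.1 b h3.2
    · exact Or.inl le_rfl
  refine Eq.trans (Finset.sum_congr ?_ fun _ _ => rfl)
    ((sign_sum_eq κ).trans (by simp only [h2]))
  ext σ
  simp only [ngrPermsOn, Finset.mem_filter, Finset.mem_univ, true_and, hκ]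
  refine and_congr_right fun _ => ⟨fun h a => ?_, fun h a ha => ?_⟩
  · by_cases ha : a ∈ S
    · by_cases ha' : σ a ∈ S
      · exact Or.inl ⟨ha', ha⟩
      · exact Or.inr (σ.injective (h _ ha'))
    · exact Or.inr (h a ha)
  · rcases h a with h4 | h4
    · exact absurd h4.2 ha
    · exact h4

/-- `IsCycleOn` admits singletons, where `τ` is the identity and the formula still gives 1. -/
theorem sign_of_mem_ngrCyclesOn {T : Finset P} (hT : T.Nonempty) {τ : Equiv.Perm P}
    (hτ : τ ∈ ngrCyclesOn T) : ((Equiv.Perm.sign τ : ℤ) : ℚ) = -(-1) ^ T.card := by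
  rw [ngrCyclesOn, Finset.mem_filter] at hτ
  obtain ⟨-, hcyc, -, hfix⟩ := hτ
  by_cases hn : T.Nontrivial
  · have h1 : τ.IsCycle := Equiv.Perm.isCycle_iff_exists_isCycleOn.2
      ⟨T, by exact_mod_cast hn, hcyc, fun x hx => by
        by_contra h; exact hx (hfix x h)⟩
    have h2 : τ.support = T := by
      ext x
      rw [Equiv.Perm.mem_support]
      refine ⟨fun hx => ?_, fun hx => hcyc.apply_ne (by exact_mod_cast hn) hx⟩
      by_contra h
      exact hx (hfix x h)
    rw [h1.sign, h2]
    simp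
  · obtain ⟨v, rfl⟩ : ∃ v, T = {v} := by
      obtain ⟨v, hv⟩ := hT
      refine ⟨v, Finset.eq_singleton_iff_unique_mem.2 ⟨hv, fun x hx => ?_⟩⟩
      exact (Set.not_nontrivial_iff.1 (show ¬ (T : Set P).Nontrivial from hn)) hx hv
    have : τ = 1 := by
      ext x
      by_cases hx : x = v
      · subst hx
        exact Equiv.Perm.isCycleOn_singleton.1 (by simpa using hcyc)
      · exact hfix x (by simpa using hx)
    simp [this]

/-- The class of `v` under a permutation. -/
def cycleClass (v : P) (σ : Equiv.Perm P) : Finset P := Finset.univ.filter fun y => σ.SameCycle v y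

theorem sum_sign_cycleClass_eq {S T : Finset P} {v : P} (hTS : T ⊆ S) (hv : v ∈ T) :
    ∑ σ ∈ ngrPermsOn S with cycleClass v σ = T, ((Equiv.Perm.sign σ : ℤ) : ℚ) =
      -(-1) ^ T.card * (ngrCyclesOn T).card * ∑ ρ ∈ ngrPermsOn (S \ T),
        ((Equiv.Perm.sign ρ : ℤ) : ℚ) := by
  have h1 : ∑ σ ∈ ngrPermsOn S with cycleClass v σ = T, ((Equiv.Perm.sign σ : ℤ) : ℚ) =
      ∑ p ∈ ngrCyclesOn T ×ˢ ngrPermsOn (S \ T),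
        ((Equiv.Perm.sign p.1 : ℤ) : ℚ) * ((Equiv.Perm.sign p.2 : ℤ) : ℚ) := by
    -- Split `σ` into its cycle through `v` and the remaining factor, which is supported on `S \ T`.
    refine Finset.sum_nbij' (fun σ => (σ.cycleOf v, (σ.cycleOf v)⁻¹ * σ)) (fun p => p.1 * p.2)
      ?_ ?_ ?_ ?_ ?_
    · intro σ hσ
      simp only [Finset.mem_filter, ngrPermsOn, Finset.mem_univ, true_and] at hσ
      obtain ⟨⟨hngr, hfix⟩, rfl⟩ := hσ
      have hmem : ∀ y, y ∈ cycleClass v σ ↔ σ.SameCycle v y := fun y => by simp [cycleClass]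
      have hτ : ∀ y, σ.cycleOf v y = if y ∈ cycleClass v σ then σ y else y := fun y => by
        rw [Equiv.Perm.cycleOf_apply]
        exact if_congr (hmem y).symm rfl rfl
      have hρ : ∀ y, ((σ.cycleOf v)⁻¹ * σ) y = if y ∈ cycleClass v σ then y else σ y := by
        intro y
        rw [Equiv.Perm.mul_apply, Equiv.Perm.inv_eq_iff_eq, hτ]
        split_ifs with h2 h3
        · rfl
        · exact absurd ((hmem _).2 (Equiv.Perm.sameCycle_apply_right.1 ((hmem _).1 h3))) h2
        · rfl
      have hmap : ∀ y, y ∈ cycleClass v σ → σ y ∈ cycleClass v σ := fun y hy =>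
        (hmem _).2 (Equiv.Perm.sameCycle_apply_right.2 ((hmem y).1 hy))
      simp only [Finset.mem_product, Finset.mem_filter, ngrPermsOn, ngrCyclesOn, Finset.mem_univ,
        true_and, Finset.mem_sdiff, not_and, not_not]
      refine ⟨⟨⟨⟨?_, (σ.cycleOf v).injective.injOn, ?_⟩, ?_⟩, fun a => ?_, fun a ha => ?_⟩,
        fun a => ?_, fun a ha => ?_⟩
      · intro y hy
        rw [hτ, if_pos (Finset.mem_coe.1 hy)]
        exact hmap y hy
      · intro y hy
        have h2 : σ.symm y ∈ cycleClass v σ := by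
          rw [hmem, ← Equiv.Perm.sameCycle_apply_right, Equiv.apply_symm_apply]
          exact (hmem y).1 hy
        exact ⟨σ.symm y, h2, by rw [hτ, if_pos h2, Equiv.apply_symm_apply]⟩
      · intro x hx y hy
        have h2 : σ.SameCycle v x := (hmem x).1 hx
        obtain ⟨k, hk⟩ := h2.symm.trans ((hmem y).1 hy)
        refine ⟨k, ?_⟩
        rw [h2.cycleOf_eq, Equiv.Perm.cycleOf_zpow_apply_self, hk]
      · rw [hτ]
        split_ifs
        exacts [hngr a, lt_irrefl a]
      · rw [hτ, if_neg ha]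
      · rw [hρ]
        split_ifs
        exacts [lt_irrefl a, hngr a]
      · rw [hρ]
        split_ifs with h2
        · rfl
        · exact hfix a fun h3 => h2 (ha h3)
    · rintro ⟨τ, ρ⟩ hp
      simp only [Finset.mem_product, Finset.mem_filter, ngrPermsOn, ngrCyclesOn, Finset.mem_univ,
        true_and, Finset.mem_sdiff, not_and, not_not] at hp ⊢
      obtain ⟨⟨hcyc, hngr, hfix⟩, hngr', hfix'⟩ := hp
      have hfix'' : ∀ a ∈ T, ρ a = a := fun a ha => hfix' a fun _ => ha
      refine ⟨⟨fun a => ?_, fun a ha => ?_⟩, ?_⟩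
      · rw [mul_apply_of_supports hfix hfix'']
        split_ifs
        exacts [hngr a, hngr' a]
      · rw [mul_apply_of_supports hfix hfix'', if_neg fun h => ha (hTS h)]
        exact hfix' a fun h => absurd h ha
      · ext y
        simp only [cycleClass, Finset.mem_filter, Finset.mem_univ, true_and]
        exact sameCycle_mul_iff hcyc hfix hfix'' hv y
    · intro σ _; simp
    · rintro ⟨τ, ρ⟩ hp
      simp only [Finset.mem_product, Finset.mem_filter, ngrPermsOn, ngrCyclesOn, Finset.mem_univ,
        true_and, Finset.mem_sdiff, not_and, not_not] at hp ⊢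
      obtain ⟨⟨hcyc, hngr, hfix⟩, hngr', hfix'⟩ := hp
      have hfix'' : ∀ a ∈ T, ρ a = a := fun a ha => hfix' a fun _ => ha
      have h2 : (τ * ρ).cycleOf v = τ := by
        ext y
        rw [Equiv.Perm.cycleOf_apply]
        simp only [sameCycle_mul_iff hcyc hfix hfix'' hv, mul_apply_of_supports hfix hfix'']
        split_ifs with h3
        · rfl
        · exact (hfix y h3).symm
      rw [h2, inv_mul_cancel_left]
    · intro σ _
      rw [← Int.cast_mul, ← Units.val_mul, ← map_mul]
      simp
  rw [h1, Finset.sum_product]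
  simp only [← Finset.mul_sum]
  rw [Finset.sum_congr rfl fun τ hτ => by rw [sign_of_mem_ngrCyclesOn ⟨v, hv⟩ hτ],
    Finset.sum_const, nsmul_eq_mul]
  ring

/-- Sort the signed sum over `ngrPermsOn S` by the cycle through `v`, and evaluate both the total
and the complementary factors by `sum_sign_ngrPermsOn`. -/
theorem sum_ngrCyclesOn (S : Finset P) {v : P} (hv : v ∈ S) :
    ∑ T ∈ S.powerset with v ∈ T, (-1 : ℚ) ^ T.card * (ngrCyclesOn T).card *
      (if PairwiseComparable (S \ T) then 1 else 0) = - if PairwiseComparable S then 1 else 0 := by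
  rw [← sum_sign_ngrPermsOn S, ← Finset.sum_fiberwise_of_maps_to (g := cycleClass v)
    (t := S.powerset.filter (v ∈ ·)), ← Finset.sum_neg_distrib]
  · refine Finset.sum_congr rfl fun T hT => ?_
    rw [Finset.mem_filter, Finset.mem_powerset] at hT
    rw [sum_sign_cycleClass_eq hT.1 hT.2, sum_sign_ngrPermsOn]
    ring
  · intro σ hσ
    simp only [Finset.mem_filter, ngrPermsOn, Finset.mem_univ, true_and] at hσ
    rw [Finset.mem_filter, Finset.mem_powerset]
    refine ⟨fun y hy => ?_,
      Finset.mem_filter.2 ⟨Finset.mem_univ v, Equiv.Perm.SameCycle.refl σ v⟩⟩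
    simp only [cycleClass, Finset.mem_filter, Finset.mem_univ, true_and] at hy
    by_contra h
    have h1 := hy.symm.eq_of_left (hσ.2 y h)
    exact h (h1 ▸ hv)

end Recursion

/-! ### The recursion for orientations with a given source -/

theorem transGen_of_mem {P : Type*} {T : Finset P} {r r' : P → P → Prop}
    (h : ∀ a b, r' a b → a ∈ T) (hr : ∀ a b, r' a b → b ∈ T → r a b) {a b : P} (hab : Relation.TransGen r' a b)
    (hb : b ∈ T) : Relation.TransGen r a b := by
  induction hab with
  | single h1 => exact .single (hr _ _ h1 hb)
  | tail _ h1 ih => exact (ih (h _ _ h1)).tail (hr _ _ h1 hb)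

/-- The only element of `T` without incoming edges is `v`. -/
def HasUniqueSource {P : Type*} (T : Finset P) (v : P) (r : P → P → Prop) : Prop :=
  ∀ x ∈ T, (∀ u, ¬ r u x) ↔ x = v

/-- Without edges every vertex of `T` is a source, so only `T = {v}` contributes. -/
theorem sum_sign_unique_source_of_empty {P : Type*} [Fintype P] {S : Finset P} {v : P}
    (hv : v ∈ S) {r : P → P → Prop} (hr : ¬ ∃ a b, r a b) :
    ∑ T ∈ S.powerset with v ∈ T ∧ (∀ a b, r a b → a ∈ T) ∧ HasUniqueSource T v r,
      (-1 : ℚ) ^ T.card = -1 := by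
  push Not at hr
  have h : (S.powerset.filter fun T => v ∈ T ∧ (∀ a b, r a b → a ∈ T) ∧ HasUniqueSource T v r) =
      {{v}} := by
    ext T
    rw [Finset.mem_filter, Finset.mem_powerset, Finset.mem_singleton]
    constructor
    · rintro ⟨-, h1, -, h2⟩
      exact Finset.eq_singleton_iff_unique_mem.2 ⟨h1, fun x hx => (h2 x hx).1 fun u => hr u x⟩
    · rintro rfl
      refine ⟨by simpa using hv, by simp, fun a b hab => absurd hab (hr a b), fun x hx => ?_⟩
      exact ⟨fun _ => by simpa using hx, fun _ u => hr u x⟩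
  rw [h]
  simp

section OneSource

variable {P : Type*} [PartialOrder P]

/-- `r` is an acyclic orientation of the incomparability graph induced on `S`. -/
structure IsAcyclicOrientationOn (S : Finset P) (r : P → P → Prop) : Prop where
  mem : ∀ {a b}, r a b → a ∈ S ∧ b ∈ S ∧ IncompRel (· ≤ ·) a b
  total : ∀ {a b}, a ∈ S → b ∈ S → IncompRel (· ≤ ·) a b → r a b ∨ r b a
  acyclic : ∀ a, ¬ Relation.TransGen r a a

theorem IsAcyclicOrientationOn.extend {S T : Finset P} {r : P → P → Prop}
    (hr : IsAcyclicOrientationOn T r) (hc : PairwiseComparable (S \ T)) (hTS : T ⊆ S) :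
    IsAcyclicOrientationOn S
      fun a b => r a b ∨ (a ∈ T ∧ b ∈ S \ T ∧ IncompRel (· ≤ ·) a b) := by
  refine ⟨?_, ?_, ?_⟩
  · rintro a b (h | ⟨h1, h2, h3⟩)
    · obtain ⟨h1, h2, h3⟩ := hr.mem h
      exact ⟨hTS h1, hTS h2, h3⟩
    · exact ⟨hTS h1, (Finset.mem_sdiff.1 h2).1, h3⟩
  · intro a b ha hb hab
    by_cases haT : a ∈ T <;> by_cases hbT : b ∈ T
    · exact (hr.total haT hbT hab).imp Or.inl Or.inl
    · exact Or.inl (Or.inr ⟨haT, Finset.mem_sdiff.2 ⟨hb, hbT⟩, hab⟩)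
    · exact Or.inr (Or.inr ⟨hbT, Finset.mem_sdiff.2 ⟨ha, haT⟩, hab.symm⟩)
    · rcases hc a (Finset.mem_sdiff.2 ⟨ha, haT⟩) b (Finset.mem_sdiff.2 ⟨hb, hbT⟩) with h | h
      exacts [absurd h hab.1, absurd h hab.2]
  · intro a ha
    have hstart : ∀ a b, (r a b ∨ (a ∈ T ∧ b ∈ S \ T ∧ IncompRel (· ≤ ·) a b)) → a ∈ T := by
      rintro a b (h | h)
      exacts [(hr.mem h).1, h.1]
    obtain ⟨c, hac, -⟩ := Relation.TransGen.head'_iff.1 ha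
    refine hr.acyclic a (transGen_of_mem hstart ?_ ha (hstart _ _ hac))
    rintro x y (h | h) hy
    · exact h
    · exact absurd hy (Finset.mem_sdiff.1 h.2.1).2

theorem IsAcyclicOrientationOn.restrict {S T : Finset P} {r : P → P → Prop}
    (hr : IsAcyclicOrientationOn S r) (hT : ∀ a b, r a b → a ∈ T) (hTS : T ⊆ S) :
    IsAcyclicOrientationOn T fun a b => r a b ∧ b ∈ T := by
  refine ⟨fun {a b} h => ⟨hT a b h.1, h.2, (hr.mem h.1).2.2⟩, fun {a b} ha hb hab => ?_,
    fun a ha => hr.acyclic a (ha.lift id fun _ _ h => h.1)⟩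
  exact (hr.total (hTS ha) (hTS hb) hab).imp (fun h => ⟨h, hb⟩) (fun h => ⟨h, ha⟩)

theorem isAcyclicOrientationOn_empty_iff {S : Finset P} :
    IsAcyclicOrientationOn S (fun _ _ => False) ↔ PairwiseComparable S := by
  constructor
  · intro h a ha b hb
    by_contra h1
    rw [not_or] at h1
    exact (h.total ha hb h1).elim id id
  · intro h
    refine ⟨fun h => h.elim, fun {a b} ha hb hab => ?_, fun a ha => ?_⟩
    · rcases h a ha b hb with h1 | h1
      exacts [absurd h1 hab.1, absurd h1 hab.2]
    · obtain ⟨c, h1, -⟩ := Relation.TransGen.head'_iff.1 ha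
      exact h1

variable [Fintype P]

/-- The acyclic orientations of the incomparability graph on `T` with the only source `v`. -/
def oneSourceOn (T : Finset P) (v : P) : Finset (P → P → Prop) :=
  Finset.univ.filter fun r => IsAcyclicOrientationOn T r ∧ HasUniqueSource T v r

/-- If `S \ T` is a chain, an orientation of `T` extends to `S` in exactly one way with all edges
starting in `T`: direct the new edges out of `T`. If it is not a chain, some edge inside `S \ T`
would start outside `T`. -/
theorem card_oneSourceOn_mul {S T : Finset P} (v : P) (hTS : T ⊆ S) :
    (oneSourceOn T v).card * (if PairwiseComparable (S \ T) then 1 else 0) =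
      (Finset.univ.filter fun r : P → P → Prop => IsAcyclicOrientationOn S r ∧
        (∀ a b, r a b → a ∈ T) ∧ HasUniqueSource T v r).card := by
  split_ifs with hc
  · rw [mul_one]
    refine Finset.card_nbij'
      (fun r a b => r a b ∨ (a ∈ T ∧ b ∈ S \ T ∧ IncompRel (· ≤ ·) a b))
      (fun r a b => r a b ∧ b ∈ T) ?_ ?_ ?_ ?_
    · intro r hr
      simp only [oneSourceOn, Finset.coe_filter, Finset.mem_univ, true_and,
        Set.mem_ofPred_eq] at hr ⊢
      refine ⟨hr.1.extend hc hTS, ?_, fun x hx => ?_⟩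
      · rintro a b (h | h)
        exacts [(hr.1.mem h).1, h.1]
      · rw [← hr.2 x hx]
        simp [hx]
    · intro r hr
      simp only [oneSourceOn, Finset.coe_filter, Finset.mem_univ, true_and,
        Set.mem_ofPred_eq] at hr ⊢
      refine ⟨hr.1.restrict hr.2.1 hTS, fun x hx => ?_⟩
      rw [← hr.2.2 x hx]
      simp [hx]
    · intro r hr
      simp only [oneSourceOn, Finset.coe_filter, Finset.mem_univ, true_and,
        Set.mem_ofPred_eq] at hr
      funext a b
      refine propext ⟨?_, fun h => ⟨Or.inl h, (hr.1.mem h).2.1⟩⟩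
      rintro ⟨h | h, hb⟩
      · exact h
      · exact absurd hb (Finset.mem_sdiff.1 h.2.1).2
    · intro r hr
      simp only [Finset.coe_filter, Finset.mem_univ, true_and, Set.mem_ofPred_eq] at hr
      funext a b
      refine propext ⟨?_, fun h => ?_⟩
      · rintro (h | ⟨ha, hb, hab⟩)
        · exact h.1
        · rw [Finset.mem_sdiff] at hb
          exact (hr.1.total (hTS ha) hb.1 hab).resolve_right fun h => hb.2 (hr.2.1 _ _ h)
      · by_cases hb : b ∈ T
        · exact Or.inl ⟨h, hb⟩
        · exact Or.inr ⟨hr.2.1 _ _ h, Finset.mem_sdiff.2 ⟨(hr.1.mem h).2.1, hb⟩, (hr.1.mem h).2.2⟩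
  · rw [mul_zero, eq_comm, Finset.card_eq_zero, Finset.filter_eq_empty_iff]
    rintro r - ⟨hr, hT, -⟩
    simp only [PairwiseComparable] at hc
    push Not at hc
    obtain ⟨a, ha, b, hb, h1, h2⟩ := hc
    rw [Finset.mem_sdiff] at ha hb
    rcases hr.total ha.1 hb.1 ⟨h1, h2⟩ with h | h
    exacts [ha.2 (hT _ _ h), hb.2 (hT _ _ h)]

/-- The sink must have an incoming edge, so that it can never count as a source in the toggling
argument. -/
theorem exists_sink {S : Finset P} {r : P → P → Prop} (hr : IsAcyclicOrientationOn S r)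
    (hne : ∃ a b, r a b) : ∃ x, (∃ u, r u x) ∧ ∀ y, ¬ r x y := by
  obtain ⟨a, b, hab⟩ := hne
  have : Std.Irrefl (Function.swap (Relation.TransGen r)) := ⟨hr.acyclic⟩
  have : IsTrans P (Function.swap (Relation.TransGen r)) := ⟨fun _ _ _ h h' => h'.trans h⟩
  have hwf : WellFounded (Function.swap (Relation.TransGen r)) :=
    Finite.wellFounded_of_trans_of_irrefl _
  obtain ⟨x, ⟨u, hu⟩, hmin⟩ := hwf.has_min {x | ∃ u, r u x} ⟨b, a, hab⟩
  exact ⟨x, ⟨u, hu⟩, fun y hy => hmin y ⟨x, hy⟩ (.single hy)⟩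

/-- If `v` has an incoming edge, no `T` qualifies. Otherwise take a sink `x` with an incoming edge:
it is not `v`, it starts no edge and it is not a source, so adding it to or removing it from `T`
preserves the conditions and reverses the sign. -/
theorem sum_sign_unique_source_of_nonempty {S : Finset P} {v : P} {r : P → P → Prop}
    (hr : IsAcyclicOrientationOn S r) (hne : ∃ a b, r a b) :
    ∑ T ∈ S.powerset with v ∈ T ∧ (∀ a b, r a b → a ∈ T) ∧ HasUniqueSource T v r,
      (-1 : ℚ) ^ T.card = 0 := by
  by_cases hv : ∃ u, r u v
  · rw [Finset.sum_eq_zero]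
    intro T hT
    obtain ⟨-, h1, -, h2⟩ := Finset.mem_filter.1 hT
    obtain ⟨u, hu⟩ := hv
    exact absurd hu ((h2 v h1).2 rfl u)
  · obtain ⟨x, ⟨u, hu⟩, hsink⟩ := exists_sink hr hne
    have hxv : x ≠ v := fun h => hv ⟨u, h ▸ hu⟩
    have hxS : x ∈ S := (hr.mem hu).2.1
    have htoggle : ∀ T T' : Finset P, (∀ y, y ≠ x → (y ∈ T ↔ y ∈ T')) →
        (v ∈ T ∧ (∀ a b, r a b → a ∈ T) ∧ HasUniqueSource T v r) →
        (v ∈ T' ∧ (∀ a b, r a b → a ∈ T') ∧ HasUniqueSource T' v r) := by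
      rintro T T' h ⟨h1, h2, h3⟩
      refine ⟨(h v hxv.symm).1 h1, fun a b hab => ?_, fun y hy => ?_⟩
      · exact (h a (by rintro rfl; exact hsink b hab)).1 (h2 a b hab)
      · by_cases hyx : y = x
        · subst hyx
          exact ⟨fun h4 => absurd hu (h4 u), fun h4 => absurd h4 hxv⟩
        · exact h3 y ((h y hyx).2 hy)
    refine Finset.sum_involution (fun T _ => if x ∈ T then T.erase x else insert x T) ?_ ?_ ?_ ?_
    · intro T hT
      split_ifs with hx
      · rw [← Finset.card_erase_add_one hx, pow_succ]
        ring
      · rw [Finset.card_insert_of_notMem hx, pow_succ]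
        ring
    · intro T hT _
      split_ifs with hx
      · exact fun h => (Finset.notMem_erase x T) (h.symm ▸ hx)
      · exact fun h => hx (h ▸ Finset.mem_insert_self x T)
    · intro T hT
      obtain ⟨h1, h2⟩ := Finset.mem_filter.1 hT
      rw [Finset.mem_powerset] at h1
      refine Finset.mem_filter.2 ⟨Finset.mem_powerset.2 ?_, htoggle T _ (fun y hy => ?_) h2⟩
      · split_ifs
        exacts [(Finset.erase_subset _ _).trans h1, Finset.insert_subset hxS h1]
      · split_ifs <;> simp [hy]
    · intro T hT
      by_cases hx : x ∈ T
      · simp [hx]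
      · simp [hx]

/-- Sum over `T` first for each orientation of `S`. Only the one without edges contributes, and it
is an orientation exactly when `S` is a chain. -/
theorem sum_oneSourceOn (S : Finset P) {v : P} (hv : v ∈ S) :
    ∑ T ∈ S.powerset with v ∈ T, (-1 : ℚ) ^ T.card * (oneSourceOn T v).card *
      (if PairwiseComparable (S \ T) then 1 else 0) = - if PairwiseComparable S then 1 else 0 := by
  have h1 : ∀ T ∈ S.powerset.filter (v ∈ ·), (-1 : ℚ) ^ T.card * (oneSourceOn T v).card *
      (if PairwiseComparable (S \ T) then 1 else 0) =
      ∑ r : P → P → Prop with IsAcyclicOrientationOn S r,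
        if (∀ a b, r a b → a ∈ T) ∧ HasUniqueSource T v r then (-1 : ℚ) ^ T.card else 0 := by
    intro T hT
    rw [Finset.mem_filter, Finset.mem_powerset] at hT
    have h2 := card_oneSourceOn_mul v hT.1
    rw [← Finset.sum_filter, Finset.sum_const, nsmul_eq_mul, Finset.filter_filter, ← h2]
    push_cast
    ring
  rw [Finset.sum_congr rfl h1, Finset.sum_comm]
  have h3 : ∀ r ∈ Finset.univ.filter fun r : P → P → Prop => IsAcyclicOrientationOn S r,
      (∑ T ∈ S.powerset with v ∈ T,
        if (∀ a b, r a b → a ∈ T) ∧ HasUniqueSource T v r then (-1 : ℚ) ^ T.card else 0) =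
      if r = fun _ _ => False then -1 else 0 := by
    intro r hr
    rw [← Finset.sum_filter, Finset.filter_filter]
    split_ifs with h
    · exact sum_sign_unique_source_of_empty hv (by simp [h])
    · refine sum_sign_unique_source_of_nonempty (Finset.mem_filter.1 hr).2 ?_
      by_contra h4
      push Not at h4
      exact h (funext₂ fun a b => propext (iff_of_false (h4 a b) id))
  rw [Finset.sum_congr rfl h3, Finset.sum_ite_eq']
  simp only [Finset.mem_filter, Finset.mem_univ, true_and, isAcyclicOrientationOn_empty_iff]
  split_ifs <;> simp

/-- The acyclic orientations with the only source `v` are equinumerous with the cycles. -/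
theorem card_oneSourceOn (S : Finset P) {v : P} (hv : v ∈ S) :
    (oneSourceOn S v).card = (ngrCyclesOn S).card := by
  induction S using Finset.strongInduction with
  | H S ih =>
    have h := (sum_oneSourceOn S hv).trans (sum_ngrCyclesOn S hv).symm
    have hmem : S ∈ S.powerset.filter (v ∈ ·) := by simp [hv]
    have hT : ∀ T ∈ (S.powerset.filter (v ∈ ·)).erase S,
        (oneSourceOn T v).card = (ngrCyclesOn T).card := fun T hT => by
      rw [Finset.mem_erase, Finset.mem_filter, Finset.mem_powerset] at hT
      exact ih T (lt_of_le_of_ne hT.2.1 hT.1) hT.2.2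
    have hs : ∑ T ∈ (S.powerset.filter (v ∈ ·)).erase S, (-1 : ℚ) ^ T.card *
        (oneSourceOn T v).card * (if PairwiseComparable (S \ T) then 1 else 0) =
      ∑ T ∈ (S.powerset.filter (v ∈ ·)).erase S, (-1 : ℚ) ^ T.card *
        (ngrCyclesOn T).card * (if PairwiseComparable (S \ T) then 1 else 0) :=
      Finset.sum_congr rfl fun T h1 => by rw [hT T h1]
    rw [← Finset.add_sum_erase _ _ hmem, ← Finset.add_sum_erase _ _ hmem, hs] at h
    -- After induction cancels the smaller `T`, only the term `T = S` is left, with coefficient `±1`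
    -- since the empty set is a chain.
    have h0 : PairwiseComparable (S \ S) := by simp [PairwiseComparable]
    rw [if_pos h0, mul_one, mul_one] at h
    have h := add_right_cancel h
    exact_mod_cast mul_left_cancel₀ (by simp : (-1 : ℚ) ^ S.card ≠ 0) h

end OneSource

/-! ### Cyclic words as rooted cycles -/

section CyclicWords

variable {P : Type*} {m : ℕ} {T : Set P}

/-- The permutation that sends each letter of a word to the cyclically next one. -/
def wordPerm (e : Fin m ≃ T) : Equiv.Perm P := Equiv.Perm.ofSubtype (e.permCongr (finRotate m))

theorem wordPerm_apply (e : Fin m ≃ T) (j : Fin m) :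
    wordPerm e (e j) = e (finRotate m j) := by
  rw [wordPerm, Equiv.Perm.ofSubtype_apply_coe]
  simp

theorem wordPerm_apply_of_notMem (e : Fin m ≃ T) {a : P} (ha : a ∉ T) : wordPerm e a = a :=
  Equiv.Perm.ofSubtype_apply_of_not_mem _ ha

theorem wordPerm_pow_apply (e : Fin m ≃ T) (hm : 0 < m) (k : ℕ) :
    (wordPerm e ^ k) (e ⟨0, hm⟩) = e ⟨k % m, Nat.mod_lt _ hm⟩ := by
  induction k with
  | zero => simp
  | succ k ih =>
    rw [pow_succ', Equiv.Perm.mul_apply, ih, wordPerm_apply]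
    congr 2
    ext
    rw [finRotate_val]
    simp

theorem isCycleOn_wordPerm (e : Fin m ≃ T) : (wordPerm e).IsCycleOn T := by
  have hmaps : ∀ a ∈ T, wordPerm e a ∈ T := fun a ha => by
    obtain ⟨j, hj⟩ := e.surjective ⟨a, ha⟩
    have h1 := wordPerm_apply e j
    rw [hj] at h1
    rw [h1]
    exact (e _).2
  refine ⟨⟨hmaps, (wordPerm e).injective.injOn, fun a ha => ?_⟩, fun a ha b hb => ?_⟩
  · obtain ⟨j, hj⟩ := e.surjective ⟨a, ha⟩
    refine ⟨e ((finRotate m).symm j), (e _).2, ?_⟩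
    rw [wordPerm_apply, Equiv.apply_symm_apply, hj]
  · have hsame : ∀ a ∈ T, ∃ v, (wordPerm e).SameCycle v a ∧ ∀ hm : 0 < m, v = e ⟨0, hm⟩ := by
      intro a ha
      obtain ⟨j, hj⟩ := e.surjective ⟨a, ha⟩
      refine ⟨e ⟨0, j.pos⟩, ⟨(j : ℕ), ?_⟩, fun _ => rfl⟩
      rw [zpow_natCast, wordPerm_pow_apply]
      simp [Nat.mod_eq_of_lt j.2, hj]
    have hm : 0 < m := (e.symm ⟨a, ha⟩).pos
    obtain ⟨v, hv, hv0⟩ := hsame a ha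
    obtain ⟨w, hw, hw0⟩ := hsame b hb
    rw [hv0 hm] at hv
    rw [hw0 hm] at hw
    exact hv.symm.trans hw

theorem isCyclicWord_iff [PartialOrder P] (e : Fin m ≃ T) :
    IsCyclicWord e ↔ IsNgrPerm (wordPerm e) := by
  rw [IsCyclicWord, IsSemistrictWord, ← cyclic_iff (fun a b : T => ¬ a > b)]
  constructor
  · intro h a
    by_cases ha : a ∈ T
    · obtain ⟨j, hj⟩ := e.surjective ⟨a, ha⟩
      have h1 := wordPerm_apply e j
      rw [hj] at h1
      rw [h1]
      have h2 := h j
      rw [hj] at h2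
      exact h2
    · rw [wordPerm_apply_of_notMem e ha]
      exact lt_irrefl a
  · intro h j
    have h1 := h (e j)
    rw [wordPerm_apply] at h1
    exact h1

/-- A cyclic word amounts to a cycle and its first letter. -/
theorem card_cyclicWords [Fintype P] [PartialOrder P] (hT : Fintype.card T = m) (hm : 0 < m) :
    Nat.card {e : Fin m ≃ T // IsCyclicWord e} = m * (ngrCyclesOn T.toFinset).card := by
  have hcard : T.toFinset.card = m := by rw [Set.toFinset_card, hT]
  have h1 : m * (ngrCyclesOn T.toFinset).card = Nat.card (T × ngrCyclesOn T.toFinset) := by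
    rw [Nat.card_prod, Nat.card_eq_fintype_card, hT, Nat.card_eq_finsetCard]
  rw [h1]
  refine Nat.card_congr (Equiv.ofBijective (fun e => (e.1 ⟨0, hm⟩, ⟨wordPerm e.1, ?_⟩)) ⟨?_, ?_⟩)
  · rw [ngrCyclesOn, Finset.mem_filter]
    refine ⟨Finset.mem_univ _, ?_, (isCyclicWord_iff _).1 e.2, fun a ha => ?_⟩
    · rw [Set.coe_toFinset]
      exact isCycleOn_wordPerm e.1
    · exact wordPerm_apply_of_notMem e.1 (by simpa using ha)
  · rintro ⟨e, he⟩ ⟨e', he'⟩ h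
    simp only [Prod.mk.injEq, Subtype.mk.injEq] at h
    ext j
    have h2 := wordPerm_pow_apply e hm j
    have h3 := wordPerm_pow_apply e' hm j
    simp only [Nat.mod_eq_of_lt j.2] at h2 h3
    rw [← h2, ← h3, h.1, h.2]
  · rintro ⟨v, σ, hσ⟩
    rw [ngrCyclesOn, Finset.mem_filter] at hσ
    obtain ⟨-, hcyc, hngr, hfix⟩ := hσ
    have hv : (v : P) ∈ T.toFinset := by simp
    have hmem : ∀ k : ℕ, (σ ^ k) v ∈ T := by
      intro k
      induction k with
      | zero => simp
      | succ k ih =>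
        rw [pow_succ', Equiv.Perm.mul_apply]
        have := (hcyc.apply_mem_iff (x := (σ ^ k) v)).2 (by simpa using ih)
        simpa using this
    -- The word recovered from a start `v` and a cycle `σ` is `v, σ v, σ² v, …`.
    let f : Fin m → T := fun k => ⟨(σ ^ (k : ℕ)) v, hmem k⟩
    have hf : Function.Injective f := fun i j hij => by
      have h2 := (hcyc.pow_apply_eq_pow_apply hv).1 (congrArg Subtype.val hij)
      rw [hcard] at h2
      exact Fin.ext (h2.eq_of_lt_of_lt i.2 j.2)
    let e : Fin m ≃ T := Equiv.ofBijective f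
      ((Fintype.bijective_iff_injective_and_card f).2 ⟨hf, by rw [hT, Fintype.card_fin]⟩)
    have he : wordPerm e = σ := by
      ext a
      by_cases ha : a ∈ T
      · obtain ⟨j, hj⟩ := e.surjective ⟨a, ha⟩
        have h2 : a = e j := by rw [hj]
        rw [h2, wordPerm_apply]
        change (σ ^ ((finRotate m j : Fin m) : ℕ)) (v : P) = σ ((σ ^ (j : ℕ)) v)
        rw [← Equiv.Perm.mul_apply, ← pow_succ', hcyc.pow_apply_eq_pow_apply hv, hcard,
          finRotate_val]
        exact Nat.mod_modEq _ _
      · rw [wordPerm_apply_of_notMem e ha, hfix a (by simpa using ha)]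
    refine ⟨⟨e, (isCyclicWord_iff e).2 (he ▸ hngr)⟩, ?_⟩
    simp only [Prod.mk.injEq, Subtype.mk.injEq]
    exact ⟨Subtype.ext (by simp [e, f]), he⟩

end CyclicWords

/-- The orientations with one source, sorted by the source. -/
theorem card_oneSource_digraphs {P : Type*} [Fintype P] [PartialOrder P] (T : Set P) :
    Nat.card {O : Digraph T // IsOrientation (incGraph T) O ∧ IsAcyclicDigraph O ∧
      ∃! v, IsSource O v} = Nat.card ((v : T) × oneSourceOn T.toFinset (v : P)) := by
  symm
  let D : (P → P → Prop) → Digraph T := fun r => ⟨fun a b => r a b⟩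
  have hsrc : ∀ {v : T} {r : P → P → Prop}, r ∈ oneSourceOn T.toFinset (v : P) →
      ∀ x, IsSource (D r) x ↔ x = v := by
    intro v r hr x
    obtain ⟨-, hr, hs⟩ := Finset.mem_filter.1 hr
    rw [← Subtype.coe_inj, ← hs x (by simp)]
    refine ⟨fun h u hu => ?_, fun h u => h u⟩
    exact h ⟨u, by simpa using (hr.mem hu).1⟩ hu
  refine Nat.card_congr (Equiv.ofBijective (fun p => ⟨D p.2.1, ?_, ?_, p.1, ?_, ?_⟩) ⟨?_, ?_⟩)
  · obtain ⟨-, hr, -⟩ := Finset.mem_filter.1 p.2.2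
    refine ⟨fun a b h => (hr.mem h).2.2, fun a b h => ?_⟩
    rcases hr.total (a := a) (b := b) (by simp) (by simp) h with h1 | h1
    · exact Or.inl ⟨h1, fun h2 => hr.acyclic _ ((Relation.TransGen.single h1).tail h2)⟩
    · exact Or.inr ⟨h1, fun h2 => hr.acyclic _ ((Relation.TransGen.single h1).tail h2)⟩
  · obtain ⟨-, hr, -⟩ := Finset.mem_filter.1 p.2.2
    exact fun a ha => hr.acyclic a (ha.lift Subtype.val fun _ _ h => h)
  · exact (hsrc p.2.2 _).2 rfl
  · exact fun y hy => (hsrc p.2.2 y).1 hy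
  · rintro ⟨v, r, hr⟩ ⟨v', r', hr'⟩ h
    have hD : D r = D r' := congrArg Subtype.val h
    have hv : v = v' := (hsrc hr' v).1 (hD ▸ (hsrc hr v).2 rfl)
    subst hv
    have hle : ∀ {r r' : P → P → Prop}, r ∈ oneSourceOn T.toFinset (v : P) → D r = D r' →
        ∀ a b, r a b → r' a b := by
      intro r r' hr hD a b hab
      have h1 := (Finset.mem_filter.1 hr).2.1.mem hab
      have h2 : (D r).Adj ⟨a, by simpa using h1.1⟩ ⟨b, by simpa using h1.2.1⟩ := hab
      rw [hD] at h2
      exact h2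
    have hrr : r = r' := funext₂ fun a b => propext ⟨hle hr hD a b, hle hr' hD.symm a b⟩
    subst hrr
    rfl
  · rintro ⟨O, hO, hac, v, hv, huniq⟩
    -- Extending the orientation to `P` by no new edges creates neither cycles nor sources in `T`.
    let r : P → P → Prop := fun a b => ∃ (ha : a ∈ T) (hb : b ∈ T), O.Adj ⟨a, ha⟩ ⟨b, hb⟩
    have htrans : ∀ a b, Relation.TransGen r a b →
        ∃ (ha : a ∈ T) (hb : b ∈ T), Relation.TransGen O.Adj ⟨a, ha⟩ ⟨b, hb⟩ := by
      intro a b hab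
      induction hab with
      | single h => exact ⟨h.1, h.2.1, .single h.2.2⟩
      | tail _ h ih => exact ⟨ih.1, h.2.1, ih.2.2.tail h.2.2⟩
    have hr : r ∈ oneSourceOn T.toFinset (v : P) := by
      refine Finset.mem_filter.2 ⟨Finset.mem_univ _, ⟨?_, ?_, ?_⟩, ?_⟩
      · rintro a b ⟨ha, hb, h⟩
        exact ⟨by simpa using ha, by simpa using hb, hO.1 _ _ h⟩
      · intro a b ha hb hab
        have ha' : a ∈ T := by simpa using ha
        have hb' : b ∈ T := by simpa using hb
        exact (hO.2 ⟨a, ha'⟩ ⟨b, hb'⟩ hab).or.imp (fun h => ⟨ha', hb', h⟩) (fun h => ⟨hb', ha', h⟩)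
      · intro a ha
        obtain ⟨h1, h2, h3⟩ := htrans a a ha
        exact hac _ h3
      · intro x hx
        have hx' : x ∈ T := by simpa using hx
        constructor
        · intro h
          exact congrArg Subtype.val (huniq ⟨x, hx'⟩ fun u hu => h u ⟨u.2, hx', hu⟩)
        · rintro rfl u ⟨hu, h1, h2⟩
          exact hv _ h2
    refine ⟨⟨v, r, hr⟩, Subtype.ext ?_⟩
    ext a b
    exact ⟨fun h => h.2.2, fun h => ⟨a.2, b.2, h⟩⟩

/-- Each of the `m` possible sources accounts for as many orientations as there are cycles, and each
cycle has `m` starting points. -/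
theorem card_cyclicWords_eq_card_orientations {P : Type*} [Fintype P] [PartialOrder P] {m : ℕ}
    {T : Set P} (hT : Fintype.card T = m) (hm : 0 < m) :
    Nat.card {e : Fin m ≃ T // IsCyclicWord e} =
      Nat.card {O : Digraph T // IsOrientation (incGraph T) O ∧ IsAcyclicDigraph O ∧
        ∃! v, IsSource O v} := by
  rw [card_cyclicWords hT hm, card_oneSource_digraphs, Nat.card_sigma]
  simp only [Nat.card_eq_finsetCard]
  have h : ∀ v : T, (oneSourceOn T.toFinset (v : P)).card = (ngrCyclesOn T.toFinset).card :=
    fun v => card_oneSourceOn T.toFinset (by simp)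
  simp only [h]
  rw [Finset.sum_const, Finset.card_univ, hT, smul_eq_mul]

/-! ### From single rows to tableaux -/

section Rows

variable {P : Type*} {n : ℕ} {lam : n.Partition}

/-- A tableau amounts to an ordered set partition and an ordering of each block. -/
theorem card_tableaux_of_rows (Φ : ∀ {m : ℕ}, (Fin m → P) → Prop) :
    Nat.card {U : PTableau P lam // ∀ i, Φ fun j => U ⟨i, j⟩} =
      Nat.card ((I : orderedSetPartitions P lam) × ((i : Fin (rows lam).length) →
        {e : Fin ((rows lam).blocksFun i) ≃ I.1 i // Φ fun j => (e j : P)})) := by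
  symm
  let F : ((I : orderedSetPartitions P lam) × ((i : Fin (rows lam).length) →
      {e : Fin ((rows lam).blocksFun i) ≃ I.1 i // Φ fun j => (e j : P)})) → Box lam → P :=
    fun p b => (p.2 b.1).1 b.2
  have hF : ∀ p, Function.Bijective (F p) := by
    rintro ⟨⟨I, hcard, hdisj, huniv⟩, e⟩
    constructor
    · rintro ⟨i, j⟩ ⟨i', j'⟩ h
      have hii : i = i' := by
        by_contra hne
        exact Set.disjoint_left.1 (hdisj hne) ((e i).1 j).2
          ((show ((e i).1 j : P) = (e i').1 j' from h) ▸ ((e i').1 j').2)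
      subst hii
      congr 1
      exact (e i).1.injective (Subtype.ext h)
    · intro a
      obtain ⟨i, hi⟩ := Set.mem_iUnion.1 (huniv ▸ Set.mem_univ a)
      obtain ⟨j, hj⟩ := (e i).1.surjective ⟨a, hi⟩
      exact ⟨⟨i, j⟩, congrArg Subtype.val hj⟩
  refine Nat.card_congr (Equiv.ofBijective
    (fun p => ⟨Equiv.ofBijective (F p) (hF p), fun i => (p.2 i).2⟩) ⟨?_, ?_⟩)
  · rintro ⟨I, e⟩ ⟨I', e'⟩ h
    have h1 : ∀ i j, ((e i).1 j : P) = (e' i).1 j := fun i j =>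
      DFunLike.congr_fun (congrArg Subtype.val h) (⟨i, j⟩ : Box lam)
    have hI : I = I' := by
      refine Subtype.ext (funext fun i => Set.ext fun a => ⟨fun ha => ?_, fun ha => ?_⟩)
      · obtain ⟨j, hj⟩ := (e i).1.surjective ⟨a, ha⟩
        have h2 := h1 i j
        rw [hj] at h2
        rw [show a = (e' i).1 j from h2]
        exact ((e' i).1 j).2
      · obtain ⟨j, hj⟩ := (e' i).1.surjective ⟨a, ha⟩
        have h2 := h1 i j
        rw [hj] at h2
        rw [show a = (e i).1 j from h2.symm]
        exact ((e i).1 j).2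
    subst hI
    congr 1
    funext i
    exact Subtype.ext (Equiv.ext fun j => Subtype.ext (h1 i j))
  · rintro ⟨U, hU⟩
    have hinj : ∀ i, Function.Injective fun j => U ⟨i, j⟩ := fun i j k h => by
      simpa using U.injective h
    refine ⟨⟨⟨fun i => Set.range fun j => U ⟨i, j⟩, fun i => ?_, fun i i' hne => ?_, ?_⟩,
      fun i => ⟨Equiv.ofInjective _ (hinj i), hU i⟩⟩, Subtype.ext (Equiv.ext fun b => rfl)⟩
    · change (Set.range fun j => U ⟨i, j⟩).ncard = _
      rw [← Set.image_univ, Set.ncard_image_of_injective _ (hinj i), Set.ncard_univ]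
      simp
    · refine Set.disjoint_left.2 ?_
      rintro a ⟨j, rfl⟩ ⟨j', h⟩
      exact hne (congrArg Sigma.fst (U.injective h)).symm
    · refine Set.eq_univ_of_forall fun a => Set.mem_iUnion.2 ?_
      obtain ⟨⟨i, j⟩, rfl⟩ := U.surjective a
      exact ⟨i, j, rfl⟩

/-- Finiteness lets equal values of `Nat.card` be turned into bijections; infinite types all have
the value 0. -/
theorem card_sigma_pi_congr {ι α : Type*} {β γ : α → ι → Type*} [∀ a i, Finite (β a i)]
    [∀ a i, Finite (γ a i)] (h : ∀ a i, Nat.card (β a i) = Nat.card (γ a i)) :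
    Nat.card ((a : α) × ((i : ι) → β a i)) = Nat.card ((a : α) × ((i : ι) → γ a i)) :=
  Nat.card_congr (Equiv.sigmaCongrRight fun a => Equiv.piCongrRight fun i =>
    (Finite.card_eq.1 (h a i)).some)

variable [Fintype P]

instance : Finite (Digraph P) :=
  Finite.of_injective (fun O : Digraph P => O.Adj) fun _ _ h => Digraph.ext h

theorem fintype_card_block (I : orderedSetPartitions P lam) (i : Fin (rows lam).length) :
    Fintype.card (I.1 i) = (rows lam).blocksFun i := by
  rw [← I.2.1 i, Set.ncard_eq_toFinset_card', Set.toFinset_card]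

variable [PartialOrder P]

theorem card_oneSourceOrientations :
    Nat.card (OneSourceOrientations (incGraph P) lam) =
      {U : PTableau P lam | CyclicallyRowSemistrict U}.ncard := by
  have h1 : {U : PTableau P lam | CyclicallyRowSemistrict U}.ncard =
      Nat.card {U : PTableau P lam // ∀ i, IsCyclicWord fun j => U ⟨i, j⟩} := by
    rw [← Nat.card_coe_set_eq]
    simp only [IsCyclicWord, forall_and]
    rfl
  rw [h1, card_tableaux_of_rows IsCyclicWord]
  refine card_sigma_pi_congr fun I i => ?_
  exact (card_cyclicWords_eq_card_orientations (fintype_card_block I i)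
    ((rows lam).one_le_blocksFun i)).symm

theorem card_recordFree :
    {U : PTableau P lam | PRecordFree U ∧ RowSemistrict U}.ncard =
      Nat.card (OneSourceOrientations (incGraph P) lam) := by
  have h1 : {U : PTableau P lam | PRecordFree U ∧ RowSemistrict U}.ncard =
      Nat.card {U : PTableau P lam // ∀ i, (IsRecordFreeWord fun j => U ⟨i, j⟩) ∧
        IsSemistrictWord fun j => U ⟨i, j⟩} := by
    rw [← Nat.card_coe_set_eq]
    simp only [forall_and]
    refine Nat.card_congr (Equiv.subtypeEquivRight fun U => and_congr_left fun _ => ?_)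
    exact Sigma.forall
  rw [h1, card_tableaux_of_rows fun u => IsRecordFreeWord u ∧ IsSemistrictWord u]
  refine card_sigma_pi_congr fun I i => ?_
  exact card_recordFree_eq (fintype_card_block I i) ((rows lam).one_le_blocksFun i)

end Rows

/-! ### Cycle covers and tableaux -/

section CycleCovers

variable {V : Type*} {D : Digraph V}

theorem directedCycle_adj_iff {m : ℕ} (i j : Fin m) :
    (directedCycle m).Adj i j ↔ finRotate m i = j := by
  rw [Fin.ext_iff, finRotate_val]
  rfl

/-- A cyclic subgraph can be parametrized starting from any of its vertices. -/
theorem DiSubgraph.IsCycle.exists_equiv {H : DiSubgraph D} {m : ℕ} (hH : H.IsCycle m) (hm : 0 < m)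
    {v : V} (hv : v ∈ H.verts) : ∃ e : Fin m ≃ H.verts, e ⟨0, hm⟩ = v ∧
      ∀ i j, H.Adj (e i) (e j) ↔ finRotate m i = j := by
  obtain ⟨e, he⟩ := hH
  have : NeZero m := ⟨hm.ne'⟩
  obtain ⟨k, hk⟩ := e.surjective ⟨v, hv⟩
  -- Translation by `k` moves the start to `v` and commutes with the cyclic successor.
  refine ⟨(Equiv.addRight k).trans e, ?_, fun i j => ?_⟩
  · have h0 : (⟨0, hm⟩ : Fin m) = 0 := rfl
    simp [h0, hk]
  · rw [Equiv.trans_apply, Equiv.trans_apply, he, directedCycle_adj_iff, finRotate_apply,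
      finRotate_apply]
    change i + k + 1 = j + k ↔ _
    rw [add_right_comm, add_left_inj]

/-- The roots are chosen independently, with `λᵢ` choices on the `i`th cycle. -/
theorem ncard_rootedCycleCovers {n : ℕ} (lam : n.Partition) :
    (rootedCycleCovers D lam).ncard = lam.parts.prod * (cycleCovers D lam).ncard := by
  have e : ∀ (H : cycleCovers D lam) (i : Fin (rows lam).length),
      Nonempty ((H.1 i).verts ≃ Fin ((rows lam).blocksFun i)) := fun H i => by
    obtain ⟨e, -⟩ := H.2.2 i
    exact ⟨e.symm⟩
  have e1 : rootedCycleCovers D lam ≃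
      (H : cycleCovers D lam) × ((i : Fin (rows lam).length) → (H.1 i).verts) :=
    { toFun := fun C => ⟨⟨C.1.1, C.2.1⟩, fun i => ⟨C.1.2 i, C.2.2 i⟩⟩
      invFun := fun C => ⟨(C.1.1, fun i => C.2 i), C.1.2, fun i => (C.2 i).2⟩
      left_inv := fun _ => rfl
      right_inv := fun _ => rfl }
  have e2 : ((H : cycleCovers D lam) × ((i : Fin (rows lam).length) → (H.1 i).verts)) ≃
      cycleCovers D lam × ((i : Fin (rows lam).length) → Fin ((rows lam).blocksFun i)) :=
    (Equiv.sigmaCongrRight fun H => Equiv.piCongrRight fun i => (e H i).some).trans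
      (Equiv.sigmaEquivProd _ _)
  rw [← Nat.card_coe_set_eq, Nat.card_congr (e1.trans e2), Nat.card_prod, Nat.card_coe_set_eq,
    Nat.card_pi, mul_comm, ← prod_blocksFun_rows]
  simp

end CycleCovers

theorem row_injective {P : Type*} {n : ℕ} {lam : n.Partition} (U : PTableau P lam)
    (i : Fin (rows lam).length) : Function.Injective fun j => U ⟨i, j⟩ := fun j k h => by
  simpa using U.injective h

section TableauCovers

variable {P : Type*} [PartialOrder P] {n : ℕ} {lam : n.Partition}

/-- The cycle on the entries of a row of a cyclically row-semistrict tableau. -/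
def rowCycle (U : PTableau P lam) (hU : CyclicallyRowSemistrict U) (i : Fin (rows lam).length) :
    DiSubgraph (ngrDigraph P) where
  verts := Set.range fun j => U ⟨i, j⟩
  Adj a b := ∃ j, a = U ⟨i, j⟩ ∧ b = U ⟨i, finRotate _ j⟩
  adj_sub := by
    rintro a b ⟨j, rfl, rfl⟩
    have h := (cyclicallyRowSemistrict_iff U).1 hU (U ⟨i, j⟩)
    rw [rowPerm_apply, rotateRows_mk] at h
    exact h
  fst_mem := by
    rintro a b ⟨j, rfl, -⟩
    exact ⟨j, rfl⟩
  snd_mem := by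
    rintro a b ⟨j, -, rfl⟩
    exact ⟨_, rfl⟩

theorem rowCycle_mem (U : PTableau P lam) (hU : CyclicallyRowSemistrict U) :
    rowCycle U hU ∈ cycleCovers (ngrDigraph P) lam := by
  refine ⟨fun i i' hne => Set.disjoint_left.2 ?_, fun i =>
    ⟨Equiv.ofInjective _ (row_injective U i), fun j k => ?_⟩⟩
  · rintro a ⟨j, rfl⟩ ⟨j', h⟩
    exact hne (congrArg Sigma.fst (U.injective h)).symm
  · rw [directedCycle_adj_iff]
    constructor
    · rintro ⟨l, h1, h2⟩
      have h3 : j = l := row_injective U i h1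
      have h4 : k = finRotate _ l := row_injective U i h2
      rw [h3, h4]
    · rintro rfl
      exact ⟨j, rfl, rfl⟩

/-- Rooted cycle covers are the cyclically row-semistrict tableaux. -/
theorem ncard_rootedCycleCovers_ngrDigraph [Fintype P] (hn : Fintype.card P = n) :
    (rootedCycleCovers (ngrDigraph P) lam).ncard =
      {U : PTableau P lam | CyclicallyRowSemistrict U}.ncard := by
  have hpos := (rows lam).one_le_blocksFun
  rw [← Nat.card_coe_set_eq, ← Nat.card_coe_set_eq]
  symm
  refine Nat.card_congr (Equiv.ofBijective (fun U =>
    ⟨(rowCycle U.1 U.2, fun i => U.1 ⟨i, ⟨0, hpos i⟩⟩), rowCycle_mem U.1 U.2,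
      fun i => ⟨_, rfl⟩⟩) ⟨?_, ?_⟩)
  · rintro ⟨U, hU⟩ ⟨U', hU'⟩ h
    have h1 := Prod.mk.inj (congrArg Subtype.val h)
    refine Subtype.ext (Equiv.ext ?_)
    -- The root fixes the first entry of the row, and the unique edge leaving an entry fixes the
    -- next one.
    rintro ⟨i, j, hj⟩
    induction j with
    | zero => exact congrFun h1.2 i
    | succ j ih =>
      have hj' : j < (rows lam).blocksFun i := by omega
      have hrot : finRotate _ (⟨j, hj'⟩ : Fin ((rows lam).blocksFun i)) = ⟨j + 1, hj⟩ := by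
        ext; rw [finRotate_val]; exact Nat.mod_eq_of_lt hj
      have h2 : (rowCycle U hU i).Adj (U ⟨i, ⟨j, hj'⟩⟩) (U ⟨i, ⟨j + 1, hj⟩⟩) :=
        ⟨⟨j, hj'⟩, rfl, by rw [hrot]⟩
      have hrow : rowCycle U hU = rowCycle U' hU' := h1.1
      rw [hrow] at h2
      obtain ⟨l, h3, h4⟩ := h2
      have h5 : (⟨j, hj'⟩ : Fin ((rows lam).blocksFun i)) = l :=
        row_injective U' i ((ih hj').symm.trans h3)
      rw [← h5, hrot] at h4
      exact h4
  · rintro ⟨⟨H, root⟩, ⟨hdisj, hcyc⟩, hroot⟩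
    choose e he0 he using fun i => (hcyc i).exists_equiv (hpos i) (hroot i)
    have hinj : Function.Injective fun b : Box lam => (e b.1 b.2 : P) := by
      rintro ⟨i, j⟩ ⟨i', j'⟩ h
      have hii : i = i' := by
        by_contra hne
        exact Set.disjoint_left.1 (hdisj hne) (e i j).2
          ((show (e i j : P) = e i' j' from h) ▸ (e i' j').2)
      subst hii
      congr 1
      exact (e i).injective (Subtype.ext h)
    -- Reading each cycle from its root fills the boxes injectively; there are `n` boxes and `n`
    -- elements, so all of `P` is used.
    let U : PTableau P lam := Equiv.ofBijective _
      ((Fintype.bijective_iff_injective_and_card _).2 ⟨hinj, (card_box lam).trans hn.symm⟩)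
    have hU : CyclicallyRowSemistrict U := by
      rw [cyclicallyRowSemistrict_iff]
      intro a
      obtain ⟨⟨i, j⟩, rfl⟩ := U.surjective a
      rw [rowPerm_apply, rotateRows_mk]
      exact (H i).adj_sub ((he i j _).2 rfl)
    refine ⟨⟨U, hU⟩, Subtype.ext (Prod.ext (funext fun i => DiSubgraph.ext ?_ ?_) (funext he0))⟩
    · ext a
      constructor
      · rintro ⟨j, rfl⟩
        exact (e i j).2
      · intro ha
        obtain ⟨j, hj⟩ := (e i).surjective ⟨a, ha⟩
        exact ⟨j, congrArg Subtype.val hj⟩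
    · funext a b
      refine propext ⟨?_, fun hab => ?_⟩
      · rintro ⟨j, rfl, rfl⟩
        exact (he i j _).2 rfl
      · obtain ⟨j, hj⟩ := (e i).surjective ⟨a, (H i).fst_mem hab⟩
        obtain ⟨k, hk⟩ := (e i).surjective ⟨b, (H i).snd_mem hab⟩
        have ha : (e i j : P) = a := congrArg Subtype.val hj
        have hb : (e i k : P) = b := congrArg Subtype.val hk
        rw [← ha, ← hb, he] at hab
        exact ⟨j, ha.symm, by rw [hab]; exact hb.symm⟩

end TableauCovers

end PosetTrace

end

theorem theoremt {P : Type*} [Fintype P] [PartialOrder P] (n : ℕ) (hn : Fintype.card P = n)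
    (lam : n.Partition) :
    (∃ g : MonoidAlgebra ℚ (Equiv.Perm (Fin n)), symmGen g = chromaticSymm (incGraph P)) ∧
    ∀ g : MonoidAlgebra ℚ (Equiv.Perm (Fin n)), symmGen g = chromaticSymm (incGraph P) →
      evalAt (powerSumTrace lam) g = {U : PTableau P lam | CyclicallyRowSemistrict U}.ncard ∧
      evalAt (powerSumTrace lam) g = {U : PTableau P lam | PRecordFree U ∧ RowSemistrict U}.ncard ∧
      evalAt (powerSumTrace lam) g = (rootedCycleCovers (ngrDigraph P) lam).ncard ∧
      evalAt (powerSumTrace lam) g = lam.parts.prod * (cycleCovers (ngrDigraph P) lam).ncard ∧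
      evalAt (powerSumTrace lam) g = Nat.card (OneSourceOrientations (incGraph P) lam) := by
  have e : P ≃ Fin n := Fintype.equivFinOfCardEq hn
  refine ⟨⟨ngrElement e, symmGen_ngrElement e⟩, fun g hg => ?_⟩
  have h : evalAt (powerSumTrace lam) g =
      {U : PTableau P lam | CyclicallyRowSemistrict U}.ncard := by
    rw [evalAt_powerSumTrace_congr lam (hg.trans (symmGen_ngrElement e).symm),
      evalAt_ngrElement e lam]
  refine ⟨h, ?_, ?_, ?_, ?_⟩
  · rw [h, card_recordFree, card_oneSourceOrientations]
  · rw [h, ncard_rootedCycleCovers_ngrDigraph hn]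
  · rw [h, ← ncard_rootedCycleCovers_ngrDigraph hn, ncard_rootedCycleCovers]
    push_cast
    rfl
  · rw [h, card_oneSourceOrientations]
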